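/- **Theorem 1.** Let $G$ be an open-loop transfer function: a function meromorphic in a neighbourhood of the closed right half plane $\{\operatorname{Re}s\ge 0\}$ for which there are $n\in\mathbb N$ and $C,R\in\mathbb R$ with $|G(s)|\le C|s|^n$ whenever $\operatorname{Re}s\ge0$ and $|s|\ge R$ (for instance $G(s)=R_0(s)e^{-\tau s}$ with $R_0$ rational, of any relative degree, and a delay $\tau\ge0$). Let $g=\frac{1}{1+G}$ be the sensitivity function of the feedback loop, regarded as a meromorphic function (removable singularities removed), and suppose that the loop is well posed in the sense that $g(x)$ grows at most polynomially as $x\to+\infty$ along the real axis (this is automatic for $G(s)=R_0(s)e^{-\tau s}$ with $1+G\not\equiv0$). Suppose that $g$ has in the open right half plane exactly the zeros $\alpha_1,\dots,\alpha_M$ and exactly the poles $\beta_1,\dots,\beta_N$ (finitely many, possibly none, listed with multiplicity); zeros and poles on the imaginary axis are allowed. (a) Let $\sigma>0$, $\eta\in\mathbb R$, and suppose that $s_0=\sigma+j\eta$ is none of the $\alpha_i,\beta_i$. Then the following integral converges absolutely and $$\int_{-\infty}^{\infty}\log|g(j\omega)|\,\frac{\sigma}{\sigma^2+(\omega-\eta)^2}\,d\omega=-\pi\left(-\log|g(s_0)|+\sum_{i=1}^{M}\log\left|\frac{s_0-\alpha_i}{s_0+\bar\alpha_i}\right|+\sum_{i=1}^{N}\log\left|\frac{s_0+\bar\beta_i}{s_0-\beta_i}\right|\right).$$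 (b) If $\zeta=\sigma+j\eta$ with $\sigma>0$ is a (non-minimum phase) zero of $G$, then $g(\zeta)=1$, the integral converges absolutely, and $$\int_{-\infty}^{\infty}\log|g(j\omega)|\,\frac{\sigma}{\sigma^2+(\omega-\eta)^2}\,d\omega=-\pi\left(\sum_{i=1}^{M}\log\left|\frac{\zeta-\alpha_i}{\zeta+\bar\alpha_i}\right|+\sum_{i=1}^{N}\log\left|\frac{\zeta+\bar\beta_i}{\zeta-\beta_i}\right|\right).$$ -/

import Mathlib

open MeasureTheory Filter Asymptotics

/-- The open right half plane. -/
def openRHP : Set ℂ := {s | 0 < s.re}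

/-- The closed right half plane (without the point at infinity). -/
def closedRHP : Set ℂ := {s | 0 ≤ s.re}

/-- The open-loop transfer functions: meromorphic at every point of the closed right half plane
(so in a neighbourhood of it), and of at most polynomial growth, of arbitrary degree, at infinity
in the closed right half plane. Every function `R(s) * exp(-τ s)` with `R` rational, of any
relative degree, and delay `τ ≥ 0` is of this kind. -/
def IsTransferFunction (G : ℂ → ℂ) : Prop :=
  MeromorphicOn G closedRHP ∧
    ∃ (n : ℕ) (C R : ℝ), ∀ s ∈ closedRHP, R ≤ ‖s‖ → ‖G s‖ ≤ C * ‖s‖ ^ n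

/-- The sensitivity function `g = 1 / (1 + G)`, as a meromorphic function: removable singularities
on the closed right half plane are removed (`g = 0` at a pole of `G`). -/
noncomputable def sensitivity (G : ℂ → ℂ) : ℂ → ℂ :=
  toMeromorphicNFOn (fun s => 1 / (1 + G s)) closedRHP

/-- Well-posedness of the loop: along the positive real axis the sensitivity function grows at
most polynomially, so closing the loop does not produce a time advance. It excludes degenerate
loops such as `1 + G(s) = exp(-s)`, and is automatic for `G(s) = R(s) * exp(-τ s)` with `R`
rational, `τ ≥ 0` and `1 + G` not identically zero. -/
def IsWellPosed (G : ℂ → ℂ) : Prop :=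
  ∃ n : ℕ, (fun x : ℝ => sensitivity G (x : ℂ)) =O[atTop] fun x : ℝ => x ^ n

/-- `a` lists the zeros of the meromorphic function `f` in the open right half plane, each as often
as its multiplicity; in particular `f` does not vanish identically there. -/
def ListsZeros (f : ℂ → ℂ) {m : ℕ} (a : Fin m → ℂ) : Prop :=
  (∀ i, a i ∈ openRHP) ∧
    ∀ s ∈ openRHP, max (meromorphicOrderAt f s) 0 = ((Nat.card {i // a i = s} : ℤ) : WithTop ℤ)

/-- `b` lists the poles of the meromorphic function `f` in the open right half plane, each as often
as its multiplicity: these are the zeros of `1 / f`. -/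
def ListsPoles (f : ℂ → ℂ) {n : ℕ} (b : Fin n → ℂ) : Prop :=
  ListsZeros f⁻¹ b

/-!
The function `1 / g = 1 + G` grows at most polynomially and has finitely many poles in the closed
right half plane, so it is a quotient `h / Q` of two bounded analytic functions, and the formula for
`g` is the difference of Jensen's formulas for `Q` and `h`. Dividing such a function by the Blaschke
product of its zeros leaves its modulus on the imaginary axis unchanged and removes the zeros in the
open half plane. If a bounded `k` has no zeros there, the Cayley transform turns `C - log |k| ≥ 0`
into a positive harmonic function on the disc that is the Poisson integral of its boundary values
plus a point mass at the image of infinity: elsewhere on the circle dominated convergence applies,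
and Fatou's lemma gives the sign of the mass. On the half plane the mass contributes `c * Re s` with
`c ≥ 0`, so `|k s| ≤ exp (C - c * Re s)`; well-posedness rules out such a decay along the positive
real axis and forces `c = 0`.
-/

section Integration

variable {X : Type*} [MeasurableSpace X] {μ : Measure X}

theorem ae_nonneg_of_tendsto {F : ℕ → X → ℝ} {f : X → ℝ}
    (hlim : ∀ᵐ x ∂μ, Tendsto (F · x) atTop (nhds (f x))) (hF₀ : ∀ n, 0 ≤ᵐ[μ] F n) :
    0 ≤ᵐ[μ] f := by
  filter_upwards [hlim, ae_all_iff.2 hF₀] with x hx hx₀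
  exact ge_of_tendsto' hx hx₀

theorem integrable_and_integral_le_of_tendsto {F : ℕ → X → ℝ} {f : X → ℝ} {A : ℝ}
    (hlim : ∀ᵐ x ∂μ, Tendsto (F · x) atTop (nhds (f x)))
    (hF : ∀ n, Integrable (F n) μ) (hF₀ : ∀ n, 0 ≤ᵐ[μ] F n) (hA : ∀ n, ∫ x, F n x ∂μ ≤ A) :
    Integrable f μ ∧ ∫ x, f x ∂μ ≤ A := by
  have hF_le (n : ℕ) : ∫⁻ x, ‖F n x‖ₑ ∂μ ≤ ENNReal.ofReal A := by
    rw [← ofReal_integral_norm_eq_lintegral_enorm (hF n)]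
    refine ENNReal.ofReal_le_ofReal ((integral_congr_ae ?_).trans_le (hA n))
    filter_upwards [hF₀ n] with x hx using Real.norm_of_nonneg hx
  have hf_le : ∫⁻ x, ‖f x‖ₑ ∂μ ≤ ENNReal.ofReal A :=
    calc ∫⁻ x, ‖f x‖ₑ ∂μ = ∫⁻ x, liminf (fun n => ‖F n x‖ₑ) atTop ∂μ :=
          lintegral_congr_ae (hlim.mono fun x hx => hx.enorm.liminf_eq.symm)
      _ ≤ liminf (fun n => ∫⁻ x, ‖F n x‖ₑ ∂μ) atTop :=
          lintegral_liminf_le' fun n => (hF n).1.aemeasurable.enorm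
      _ ≤ liminf (fun _ => ENNReal.ofReal A) atTop := liminf_le_liminf (.of_forall hF_le)
      _ = ENNReal.ofReal A := liminf_const _
  have hf : Integrable f μ :=
    ⟨aestronglyMeasurable_of_tendsto_ae _ (fun n => (hF n).1) hlim,
      hf_le.trans_lt ENNReal.ofReal_lt_top⟩
  have hA₀ : 0 ≤ A := (integral_nonneg_of_ae (hF₀ 0)).trans (hA 0)
  refine ⟨hf, (integral_mono hf hf.norm fun x => Real.le_norm_self _).trans ?_⟩
  rwa [← ENNReal.ofReal_le_ofReal_iff hA₀, ofReal_integral_norm_eq_lintegral_enorm hf]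

theorem abs_setIntegral_mul_le {u p : X → ℝ} {K : Set X} {ε A : ℝ} (hK : MeasurableSet K)
    (hε : 0 ≤ ε) (hp : ∀ᵐ x ∂μ, x ∈ K → |p x| ≤ ε) (hu : Integrable u μ) (hu₀ : 0 ≤ᵐ[μ] u)
    (hA : ∫ x, u x ∂μ ≤ A) : |∫ x in K, p x * u x ∂μ| ≤ ε * A := by
  calc |∫ x in K, p x * u x ∂μ| ≤ ∫ x in K, ε * u x ∂μ := by
        rw [← Real.norm_eq_abs]
        refine norm_integral_le_of_norm_le (hu.const_mul ε).integrableOn ?_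
        rw [ae_restrict_iff' hK]
        filter_upwards [hp, hu₀] with x hx hx₀ hxK
        rw [Real.norm_eq_abs, abs_mul, abs_of_nonneg hx₀]
        exact mul_le_mul_of_nonneg_right (hx hxK) hx₀
    _ = ε * ∫ x in K, u x ∂μ := integral_const_mul _ _
    _ ≤ ε * A := mul_le_mul_of_nonneg_left ((setIntegral_le_integral hu hu₀).trans hA) hε

theorem tendsto_setIntegral_mul_of_dominated {F : ℕ → X → ℝ} {f p B : X → ℝ} {K : Set X} {M : ℝ}
    (hlim : ∀ᵐ x ∂μ, Tendsto (F · x) atTop (nhds (f x))) (hF : ∀ n, Integrable (F n) μ)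
    (hp : AEStronglyMeasurable p μ) (hpM : ∀ᵐ x ∂μ, |p x| ≤ M)
    (hK : MeasurableSet K) (hB : IntegrableOn B K μ)
    (hFB : ∀ᶠ n in atTop, ∀ᵐ x ∂μ, x ∈ K → |F n x| ≤ B x) :
    Tendsto (fun n => ∫ x in K, p x * F n x ∂μ) atTop (nhds (∫ x in K, p x * f x ∂μ)) := by
  refine tendsto_integral_filter_of_dominated_convergence (fun x => M * B x)
    (.of_forall fun n => (hp.mul (hF n).1).restrict) ?_ (hB.const_mul M)
    (ae_restrict_of_ae <| hlim.mono fun x hx => hx.const_mul _)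
  filter_upwards [hFB] with n hn
  rw [ae_restrict_iff' hK]
  filter_upwards [hpM, hn] with x hpx hFx hxK
  rw [norm_mul]
  exact mul_le_mul hpx (hFx hxK) (abs_nonneg _) ((abs_nonneg _).trans hpx)

theorem tendsto_integral_mul_of_small_off {F : ℕ → X → ℝ} {f p : X → ℝ} {A M : ℝ}
    (hlim : ∀ᵐ x ∂μ, Tendsto (F · x) atTop (nhds (f x)))
    (hF : ∀ n, Integrable (F n) μ) (hF₀ : ∀ n, 0 ≤ᵐ[μ] F n) (hA : ∀ n, ∫ x, F n x ∂μ ≤ A)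
    (hp : AEStronglyMeasurable p μ) (hpM : ∀ᵐ x ∂μ, |p x| ≤ M)
    (hK : ∀ ε > 0, ∃ K, MeasurableSet K ∧ (∀ᵐ x ∂μ, x ∈ Kᶜ → |p x| ≤ ε) ∧
      ∃ B, IntegrableOn B K μ ∧ ∀ᶠ n in atTop, ∀ᵐ x ∂μ, x ∈ K → |F n x| ≤ B x) :
    Tendsto (fun n => ∫ x, p x * F n x ∂μ) atTop (nhds (∫ x, p x * f x ∂μ)) := by
  obtain ⟨hf, hfA⟩ := integrable_and_integral_le_of_tendsto hlim hF hF₀ hA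
  have hA₀ : 0 ≤ A := (integral_nonneg_of_ae (hF₀ 0)).trans (hA 0)
  have hpu {u : X → ℝ} (hu : Integrable u μ) : Integrable (fun x => p x * u x) μ :=
    hu.bdd_mul hp (by simpa using hpM)
  rw [Metric.tendsto_atTop]
  intro ε hε
  obtain ⟨K, hKm, hpK, B, hB, hFB⟩ := hK (ε / (4 * (A + 1))) (by positivity)
  obtain ⟨N, hN⟩ := Metric.tendsto_atTop.1
    (tendsto_setIntegral_mul_of_dominated hlim hF hp hpM hKm hB hFB) (ε / 2) (by positivity)
  refine ⟨N, fun n hn => ?_⟩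
  have hoff {u : X → ℝ} (hu : Integrable u μ) (hu₀ : 0 ≤ᵐ[μ] u) (huA : ∫ x, u x ∂μ ≤ A) :
      |∫ x in Kᶜ, p x * u x ∂μ| < ε / 4 := by
    refine (abs_setIntegral_mul_le hKm.compl (by positivity) hpK hu hu₀ huA).trans_lt ?_
    rw [div_mul_eq_mul_div, div_lt_div_iff₀ (by positivity) (by positivity)]
    nlinarith
  have hon := hN n hn
  have hFn := hoff (hF n) (hF₀ n) (hA n)
  have hf' := hoff hf (ae_nonneg_of_tendsto hlim hF₀) hfA
  rw [Real.dist_eq] at hon ⊢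
  rw [← integral_add_compl hKm (hpu (hF n)), ← integral_add_compl hKm (hpu hf)]
  grind [abs_lt]

theorem ae_of_forall_eventually_nhdsNE {T : Set ℝ} {p : ℝ → Prop}
    (h : ∀ t ∈ T, ∀ᶠ x in nhdsWithin t {t}ᶜ, p x) : ∀ᵐ t, t ∈ T → p t := by
  rw [ae_iff]
  refine measure_null_of_locally_null _ fun t ht => ?_
  rw [Set.mem_ofPred_eq, Classical.not_imp] at ht
  refine ⟨_, inter_mem_nhdsWithin _ (eventually_nhdsWithin_iff.1 (h t ht.1)),
    measure_mono_null ?_ (measure_singleton t)⟩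
  rintro x ⟨hx, hpx⟩
  grind

end Integration

section

open Metric Set Real Topology InnerProductSpace ComplexConjugate

section RadialDomination

theorem abs_log_mul_le (a b : ℝ) : |log (a * b)| ≤ |log a| + |log b| := by
  rcases eq_or_ne a 0 with rfl | ha
  · simp
  rcases eq_or_ne b 0 with rfl | hb
  · simp
  rw [Real.log_mul ha hb]
  exact abs_add_le _ _

theorem exists_abs_log_norm_le_of_analyticAt {𝕜 E : Type*} [NontriviallyNormedField 𝕜]
    [NormedAddCommGroup E] [NormedSpace 𝕜 E] {f : 𝕜 → E} {z₀ : 𝕜} (hf : AnalyticAt 𝕜 f z₀)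
    (hf₀ : ¬ ∀ᶠ z in 𝓝 z₀, f z = 0) :
    ∃ (n : ℕ) (C : ℝ), ∀ᶠ z in 𝓝 z₀, |log ‖f z‖| ≤ n * |log ‖z - z₀‖| + C := by
  obtain ⟨n, k, hk, hk₀, hfk⟩ := hf.exists_eventuallyEq_pow_smul_nonzero_iff.2 hf₀
  have hlog : ContinuousAt (fun z => |log ‖k z‖|) z₀ :=
    (hk.continuousAt.norm.log (norm_ne_zero_iff.2 hk₀)).abs
  refine ⟨n, |log ‖k z₀‖| + 1, ?_⟩
  filter_upwards [hfk, hlog.eventually_lt continuousAt_const (lt_add_one _)] with z hz hkz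
  rw [hz, norm_smul, norm_pow]
  refine (abs_log_mul_le _ _).trans (add_le_add ?_ hkz.le)
  rw [Real.log_pow, abs_mul, Nat.abs_cast]

theorem abs_log_norm_mul_sub_le {ζ ζ₀ : ℂ} (hζ : ‖ζ‖ = 1) (hζ₀ : ‖ζ₀‖ = 1) (hne : ζ ≠ ζ₀)
    {r : ℝ} (hr₀ : 0 ≤ r) (hr₁ : r ≤ 1) :
    |log ‖r * ζ - ζ₀‖| ≤ log 2 + |log ‖ζ - ζ₀‖| := by
  have hr : ‖(r : ℂ) * ζ‖ = r := by simp [hζ, abs_of_nonneg hr₀]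
  have hdist_circle : ‖ζ - r * ζ‖ = 1 - r := by
    rw [← one_sub_mul, norm_mul, hζ, mul_one, ← Complex.ofReal_one, ← Complex.ofReal_sub,
      Complex.norm_real, Real.norm_of_nonneg (sub_nonneg.2 hr₁)]
  have hdist_ge : 1 - r ≤ ‖r * ζ - ζ₀‖ := by
    have h := norm_sub_norm_le ζ₀ (r * ζ)
    rwa [hr, hζ₀, norm_sub_rev] at h
  have hlower : ‖ζ - ζ₀‖ ≤ 2 * ‖r * ζ - ζ₀‖ := by
    linarith [norm_sub_le_norm_sub_add_norm_sub ζ (r * ζ) ζ₀]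
  have hupper : ‖r * ζ - ζ₀‖ ≤ 2 := by linarith [norm_sub_le (r * ζ) ζ₀]
  have hpos : 0 < ‖ζ - ζ₀‖ := norm_pos_iff.2 (sub_ne_zero.2 hne)
  have hpos' : 0 < ‖r * ζ - ζ₀‖ := by linarith
  have hlog_lower := Real.log_le_log hpos hlower
  rw [Real.log_mul two_ne_zero hpos'.ne'] at hlog_lower
  have hlog_upper := Real.log_le_log hpos' hupper
  grind [abs_le]

theorem circleMap_zero_eq_mul (r θ : ℝ) : circleMap 0 r θ = r * circleMap 0 1 θ := by
  simp [circleMap]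

theorem tendsto_circleMap_nhdsLT_one_prod (θ : ℝ) :
    Tendsto (fun p : ℝ × ℝ => circleMap 0 p.1 p.2) (𝓝[<] 1 ×ˢ 𝓝 θ) (𝓝 (circleMap 0 1 θ)) := by
  have hcont : Continuous fun p : ℝ × ℝ => circleMap 0 p.1 p.2 := by
    simp only [circleMap]
    fun_prop
  refine (hcont.tendsto (1, θ)).mono_left ?_
  rw [nhds_prod_eq]
  exact prod_mono_left _ nhdsWithin_le_nhds

/-- `RadiallyDominatedOn u S`: on the rays towards the points `exp (θ * I)`, `θ ∈ S`, of the unit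
circle, the restrictions of `u` to the circles of radius `r → 1⁻` have a common majorant that is
integrable over the whole circle. It is the hypothesis of dominated convergence for radial
limits. -/
def RadiallyDominatedOn (u : ℂ → ℝ) (S : Set ℝ) : Prop :=
  ∃ B : ℝ → ℝ, IntegrableOn B (Ioo 0 (2 * π)) ∧
    ∀ᶠ r : ℝ in 𝓝[<] 1, ∀ᵐ θ, θ ∈ S → |u (circleMap 0 r θ)| ≤ B θ

theorem RadiallyDominatedOn.mono {u : ℂ → ℝ} {S T : Set ℝ} (hST : S ⊆ T)
    (h : RadiallyDominatedOn u T) : RadiallyDominatedOn u S := by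
  obtain ⟨B, hB, hBu⟩ := h
  exact ⟨B, hB, hBu.mono fun r hr => hr.mono fun θ hθ hS => hθ (hST hS)⟩

theorem RadiallyDominatedOn.union {u : ℂ → ℝ} {S T : Set ℝ} (hS : RadiallyDominatedOn u S)
    (hT : RadiallyDominatedOn u T) : RadiallyDominatedOn u (S ∪ T) := by
  obtain ⟨B, hB, hBu⟩ := hS
  obtain ⟨B', hB', hBu'⟩ := hT
  refine ⟨fun θ => |B θ| + |B' θ|, hB.abs.add hB'.abs, ?_⟩
  filter_upwards [hBu, hBu'] with r hr hr'
  filter_upwards [hr, hr'] with θ hθ hθ'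
  rintro (h | h)
  · linarith [hθ h, le_abs_self (B θ), abs_nonneg (B' θ)]
  · linarith [hθ' h, le_abs_self (B' θ), abs_nonneg (B θ)]

theorem RadiallyDominatedOn.const_sub {u : ℂ → ℝ} {S : Set ℝ} (c : ℝ)
    (h : RadiallyDominatedOn u S) : RadiallyDominatedOn (fun z => c - u z) S := by
  obtain ⟨B, hB, hBu⟩ := h
  refine ⟨fun θ => |c| + B θ, (integrableOn_const measure_Ioo_lt_top.ne).add hB, ?_⟩
  exact hBu.mono fun r hr => hr.mono fun θ hθ hS =>
    (abs_sub _ _).trans (add_le_add_right (hθ hS) _)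

theorem radiallyDominatedOn_of_isCompact {u : ℂ → ℝ} {K : Set ℝ} (hK : IsCompact K)
    (h : ∀ θ ∈ K, ∃ S ∈ 𝓝 θ, RadiallyDominatedOn u S) : RadiallyDominatedOn u K := by
  refine hK.induction_on (p := RadiallyDominatedOn u)
    ⟨0, integrableOn_zero, .of_forall fun r => .of_forall fun θ hθ => hθ.elim⟩
    (fun _ _ hST hT => hT.mono hST) (fun _ _ => .union) fun θ hθ => ?_
  obtain ⟨S, hS, hSu⟩ := h θ hθ
  exact ⟨S, mem_nhdsWithin_of_mem_nhds hS, hSu⟩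

theorem exists_nhds_radiallyDominatedOn_log_norm {H : ℂ → ℂ} {θ₀ : ℝ}
    (hH : AnalyticAt ℂ H (circleMap 0 1 θ₀)) (hH₀ : ¬ ∀ᶠ z in 𝓝 (circleMap 0 1 θ₀), H z = 0) :
    ∃ S ∈ 𝓝 θ₀, RadiallyDominatedOn (fun z => log ‖H z‖) S := by
  set ζ₀ := circleMap 0 1 θ₀
  obtain ⟨n, C, hnC⟩ := exists_abs_log_norm_le_of_analyticAt hH hH₀
  obtain ⟨p, hp, q, hq, hpq⟩ := eventually_prod_iff.1
    ((tendsto_circleMap_nhdsLT_one_prod θ₀).eventually hnC)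
  have hconst (c : ℝ) : IntegrableOn (fun _ => c) (Ioo 0 (2 * π)) :=
    integrableOn_const measure_Ioo_lt_top.ne
  have hlog : IntegrableOn (fun θ => log ‖circleMap 0 1 θ - ζ₀‖) (Ioo 0 (2 * π)) :=
    (intervalIntegrable_iff_integrableOn_Ioo_of_le two_pi_pos.le).1
      (circleIntegrable_log_norm_sub_const 1)
  refine ⟨{θ | q θ}, hq, fun θ => n * (log 2 + |log ‖circleMap 0 1 θ - ζ₀‖|) + C,
    (((hconst _).add hlog.abs).const_mul _).add (hconst _), ?_⟩
  have hne : ∀ᵐ θ : ℝ, circleMap 0 1 θ ≠ ζ₀ :=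
    ((countable_singleton ζ₀).preimage_circleMap 0 one_ne_zero).ae_notMem _
  filter_upwards [hp, Ioo_mem_nhdsLT zero_lt_one] with r hr hr01
  filter_upwards [hne] with θ hθ hqθ
  refine (hpq hr hqθ).trans ?_
  rw [circleMap_zero_eq_mul]
  gcongr
  exact abs_log_norm_mul_sub_le (by simp) (by simp [ζ₀]) hθ hr01.1.le hr01.2.le

end RadialDomination

section UnitDisc

theorem circleAverage_zero_one_eq_setIntegral (f : ℂ → ℝ) :
    circleAverage f 0 1 = (2 * π)⁻¹ * ∫ θ in Ioo 0 (2 * π), f (circleMap 0 1 θ) := by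
  rw [circleAverage_def, smul_eq_mul, intervalIntegral.integral_of_le two_pi_pos.le,
    integral_Ioc_eq_integral_Ioo]

theorem circleIntegrable_zero_one_iff {f : ℂ → ℝ} :
    CircleIntegrable f 0 1 ↔ IntegrableOn (fun θ => f (circleMap 0 1 θ)) (Ioo 0 (2 * π)) :=
  intervalIntegrable_iff_integrableOn_Ioo_of_le two_pi_pos.le

theorem continuousOn_poissonKernel_sphere {w : ℂ} (hw : w ∈ ball 0 1) :
    ContinuousOn (poissonKernel 0 w) (sphere 0 1) := by
  rw [poissonKernel_eq_re_herglotzRieszKernel]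
  have h := continuousOn_herglotzRieszKernel_sphere hw
  rw [abs_one] at h
  exact Complex.continuous_re.comp_continuousOn h

theorem circleAverage_poissonKernel {w : ℂ} (hw : w ∈ ball 0 1) :
    circleAverage (poissonKernel 0 w) 0 1 = 1 := by
  have hone : HarmonicOnNhd (fun _ : ℂ => (1 : ℝ)) (closedBall 0 1) := fun _ _ => harmonicAt_const 1
  have h := hone.circleAverage_poissonKernel_smul hw
  rwa [show poissonKernel 0 w • (fun _ : ℂ => (1 : ℝ)) = poissonKernel 0 w from mul_one _] at h

theorem circleAverage_poissonKernel_mul_dilation {u : ℂ → ℝ} (hu : HarmonicOnNhd u (ball 0 1))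
    {r : ℝ} (hr : r ∈ Ioo 0 1) {w : ℂ} (hw : w ∈ ball 0 1) :
    circleAverage (fun z => poissonKernel 0 w z * u (r * z)) 0 1 = u (r * w) := by
  have hr₀ : (r : ℂ) ≠ 0 := by exact_mod_cast hr.1.ne'
  have hrw : (r * w : ℂ) ∈ ball (0 : ℂ) r := by
    rw [mem_ball_zero_iff] at hw ⊢
    rw [norm_mul, Complex.norm_real, norm_of_nonneg hr.1.le]
    exact mul_lt_of_lt_one_right hr.1 hw
  have hur : HarmonicOnNhd u (closedBall 0 r) := fun z hz =>
    hu z (closedBall_subset_ball hr.2 hz)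
  rw [← hur.circleAverage_poissonKernel_smul hrw, circleAverage_eq_circleAverage_zero_one (R := r)]
  congr 1 with z
  have hkernel : poissonKernel 0 (r * w) (r * z) = poissonKernel 0 w z := by
    simp only [poissonKernel_def, sub_zero, ← mul_sub, norm_mul, mul_pow]
    exact mul_div_mul_left _ _ (by simpa using hr₀)
  simp only [add_zero, Pi.smul_apply', smul_eq_mul, hkernel]

theorem exists_seq_tendsto_one : ∃ r : ℕ → ℝ, (∀ n, r n ∈ Ioo 0 1) ∧ Tendsto r atTop (𝓝 1) := by
  obtain ⟨r, -, hr, hr₁⟩ := exists_seq_strictMono_tendsto' (zero_lt_one (α := ℝ))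
  exact ⟨r, hr, hr₁⟩

theorem tendsto_ofReal_mul_nhds {r : ℕ → ℝ} (hr : Tendsto r atTop (𝓝 1)) (z : ℂ) :
    Tendsto (fun n => (r n : ℂ) * z) atTop (𝓝 z) := by
  simpa using ((Complex.continuous_ofReal.tendsto 1).comp hr).mul_const z

theorem circleMap_zero_mem_ball {r : ℝ} (hr : r ∈ Ioo 0 1) (θ : ℝ) :
    circleMap 0 r θ ∈ ball (0 : ℂ) 1 := by
  rw [mem_ball_zero_iff, norm_circleMap_zero, abs_of_pos hr.1]
  exact hr.2

/-- Nonnegative harmonic functions on the unit disc whose values at the points of the unit circle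
other than `1` are, almost everywhere, radial limits, dominated on closed arcs avoiding `1`.
Nothing is assumed near `1`, which is where the Cayley transform puts the point at infinity of the
half plane. -/
structure HasRadialBoundaryValuesOffOne (u : ℂ → ℝ) : Prop where
  harmonicOnNhd : HarmonicOnNhd u (ball 0 1)
  nonneg : ∀ z ∈ ball (0 : ℂ) 1, 0 ≤ u z
  tendsto : ∀ᵐ θ, θ ∈ Ioo 0 (2 * π) →
    Tendsto (fun r : ℝ => u (circleMap 0 r θ)) (𝓝[<] 1) (𝓝 (u (circleMap 0 1 θ)))
  radiallyDominatedOn : ∀ K ⊆ Ioo 0 (2 * π), IsCompact K → RadiallyDominatedOn u K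

namespace HasRadialBoundaryValuesOffOne

variable {u : ℂ → ℝ} {r : ℕ → ℝ}

theorem tendsto_seq (hu : HasRadialBoundaryValuesOffOne u) (hr : ∀ n, r n ∈ Ioo 0 1)
    (hr₁ : Tendsto r atTop (𝓝 1)) :
    ∀ᵐ θ ∂volume.restrict (Ioo 0 (2 * π)),
      Tendsto (fun n => u (circleMap 0 (r n) θ)) atTop (𝓝 (u (circleMap 0 1 θ))) := by
  rw [ae_restrict_iff' measurableSet_Ioo]
  have hr₁' : Tendsto r atTop (𝓝[<] 1) :=
    tendsto_nhdsWithin_iff.2 ⟨hr₁, .of_forall fun n => (hr n).2⟩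
  exact hu.tendsto.mono fun θ hθ hmem => (hθ hmem).comp hr₁'

theorem integrableOn_dilation (hu : HasRadialBoundaryValuesOffOne u) {ρ : ℝ} (hρ : ρ ∈ Ioo 0 1) :
    IntegrableOn (fun θ => u (circleMap 0 ρ θ)) (Ioo 0 (2 * π)) := by
  have hcont : Continuous fun θ => u (circleMap 0 ρ θ) :=
    continuous_iff_continuousAt.2 fun θ => ContinuousAt.comp (f := circleMap 0 ρ)
      (hu.harmonicOnNhd _ (circleMap_zero_mem_ball hρ θ)).1.continuousAt
      (continuous_circleMap 0 ρ).continuousAt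
  exact hcont.integrableOn_Icc.mono_set Ioo_subset_Icc_self

theorem setIntegral_dilation (hu : HasRadialBoundaryValuesOffOne u) {ρ : ℝ} (hρ : ρ ∈ Ioo 0 1) :
    ∫ θ in Ioo 0 (2 * π), u (circleMap 0 ρ θ) = 2 * π * u 0 := by
  have h := circleAverage_poissonKernel_mul_dilation hu.harmonicOnNhd hρ (mem_ball_self one_pos)
  rw [circleAverage_zero_one_eq_setIntegral, mul_zero, inv_mul_eq_iff_eq_mul₀ two_pi_pos.ne'] at h
  rw [← h]
  congr 1 with θ
  rw [circleMap_zero_eq_mul]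
  simp [poissonKernel_def]

theorem circleIntegrable_and_circleAverage_le (hu : HasRadialBoundaryValuesOffOne u) :
    CircleIntegrable u 0 1 ∧ circleAverage u 0 1 ≤ u 0 := by
  obtain ⟨r, hr, hr₁⟩ := exists_seq_tendsto_one
  rw [circleIntegrable_zero_one_iff, circleAverage_zero_one_eq_setIntegral,
    inv_mul_le_iff₀ two_pi_pos]
  exact integrable_and_integral_le_of_tendsto (hu.tendsto_seq hr hr₁)
    (fun n => hu.integrableOn_dilation (hr n))
    (fun n => .of_forall fun θ => hu.nonneg _ (circleMap_zero_mem_ball (hr n) θ))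
    (fun n => (hu.setIntegral_dilation (hr n)).le)

/-- The weight `q` vanishes at `1`, so the mass of `u` that may concentrate there is lost without
consequence. -/
theorem tendsto_circleAverage_mul_dilation (hu : HasRadialBoundaryValuesOffOne u) {q : ℂ → ℝ}
    (hq : ContinuousOn q (sphere 0 1)) (hq₁ : q 1 = 0) (hr : ∀ n, r n ∈ Ioo 0 1)
    (hr₁ : Tendsto r atTop (𝓝 1)) :
    Tendsto (fun n => circleAverage (fun z => q z * u (r n * z)) 0 1) atTop
      (𝓝 (circleAverage (fun z => q z * u z) 0 1)) := by
  have hp : Continuous fun θ => q (circleMap 0 1 θ) :=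
    hq.comp_continuous (continuous_circleMap 0 1) fun θ => by simp
  obtain ⟨M, hM⟩ := (isCompact_sphere (0 : ℂ) 1).exists_bound_of_continuousOn hq
  simp only [circleAverage_zero_one_eq_setIntegral, ← circleMap_zero_eq_mul]
  refine (tendsto_integral_mul_of_small_off (hu.tendsto_seq hr hr₁)
    (fun n => hu.integrableOn_dilation (hr n))
    (fun n => .of_forall fun θ => hu.nonneg _ (circleMap_zero_mem_ball (hr n) θ))
    (fun n => (hu.setIntegral_dilation (hr n)).le)
    hp.aestronglyMeasurable (M := M) (.of_forall fun θ => hM _ (by simp)) ?_).const_mul _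
  intro ε hε
  set K := Icc 0 (2 * π) ∩ {θ | ε ≤ |q (circleMap 0 1 θ)|}
  have hKc : IsCompact K := isCompact_Icc.inter_right (isClosed_le continuous_const hp.abs)
  have hKsub : K ⊆ Ioo 0 (2 * π) := by
    rintro θ ⟨hθ, hθε⟩
    have hθ₁ : circleMap 0 1 θ ≠ 1 := fun h => by simp [h, hq₁, hε.not_ge] at hθε
    refine ⟨hθ.1.lt_of_ne ?_, hθ.2.lt_of_ne ?_⟩ <;> rintro rfl <;> simp [circleMap] at hθ₁
  refine ⟨K, hKc.measurableSet, (ae_restrict_iff' measurableSet_Ioo).2 (.of_forall ?_), ?_⟩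
  · intro θ hθ hθK
    exact (not_le.1 fun h => hθK ⟨Ioo_subset_Icc_self hθ, h⟩).le
  · obtain ⟨B, hB, hBu⟩ := hu.radiallyDominatedOn K hKsub hKc
    have hr₁' : Tendsto r atTop (𝓝[<] 1) :=
      tendsto_nhdsWithin_iff.2 ⟨hr₁, .of_forall fun n => (hr n).2⟩
    exact ⟨B, Integrable.integrableOn hB,
      (hr₁'.eventually hBu).mono fun n hn => ae_restrict_of_ae hn⟩

theorem circleIntegrable_mul_dilation (hu : HasRadialBoundaryValuesOffOne u) {q : ℂ → ℝ}
    (hq : ContinuousOn q (sphere 0 1)) {ρ : ℝ} (hρ : ρ ∈ Ioo 0 1) :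
    CircleIntegrable (fun z => q z * u (ρ * z)) 0 1 := by
  refine CircleIntegrable.continuousOn_mul ?_ (by rwa [abs_one])
  rw [circleIntegrable_zero_one_iff]
  simpa only [← circleMap_zero_eq_mul] using hu.integrableOn_dilation hρ

theorem sub_mul_eq_circleAverage (hu : HasRadialBoundaryValuesOffOne u) {w : ℂ}
    (hw : w ∈ ball 0 1) :
    u w - poissonKernel 0 w 1 * u 0 =
      circleAverage (fun z => (poissonKernel 0 w z - poissonKernel 0 w 1) * u z) 0 1 := by
  obtain ⟨r, hr, hr₁⟩ := exists_seq_tendsto_one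
  have hP := continuousOn_poissonKernel_sphere hw
  have hboundary := hu.tendsto_circleAverage_mul_dilation
    (q := fun z => poissonKernel 0 w z - poissonKernel 0 w 1)
    (hP.sub continuousOn_const) (sub_self _) hr hr₁
  have hinterior : Tendsto (fun n => u (r n * w) - poissonKernel 0 w 1 * u 0) atTop
      (𝓝 (u w - poissonKernel 0 w 1 * u 0)) :=
    ((hu.harmonicOnNhd w hw).1.continuousAt.tendsto.comp
      (tendsto_ofReal_mul_nhds hr₁ w)).sub_const _
  refine tendsto_nhds_unique (hinterior.congr fun n => ?_) hboundary
  have hmean : circleAverage (fun z => poissonKernel 0 w 1 * u (r n * z)) 0 1 =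
      poissonKernel 0 w 1 * u 0 := by
    have h := circleAverage_poissonKernel_mul_dilation hu.harmonicOnNhd (hr n)
      (mem_ball_self one_pos)
    rw [mul_zero] at h
    rw [← h, ← smul_eq_mul, ← circleAverage_fun_smul]
    exact circleAverage_congr_sphere fun z hz => by
      simp only [abs_one, mem_sphere_zero_iff_norm] at hz
      simp [poissonKernel_def, hz]
  rw [← circleAverage_poissonKernel_mul_dilation hu.harmonicOnNhd (hr n) hw, ← hmean,
    ← circleAverage_fun_sub (hu.circleIntegrable_mul_dilation hP (hr n))
      (hu.circleIntegrable_mul_dilation continuousOn_const (hr n))]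
  simp only [sub_mul]

theorem exists_eq_circleAverage_add (hu : HasRadialBoundaryValuesOffOne u) :
    ∃ c, 0 ≤ c ∧ ∀ w ∈ ball (0 : ℂ) 1,
      u w = circleAverage (fun z => poissonKernel 0 w z * u z) 0 1 + c * poissonKernel 0 w 1 := by
  obtain ⟨hint, hle⟩ := hu.circleIntegrable_and_circleAverage_le
  refine ⟨u 0 - circleAverage u 0 1, sub_nonneg.2 hle, fun w hw => ?_⟩
  have hPu : CircleIntegrable (fun z => poissonKernel 0 w z * u z) 0 1 :=
    hint.continuousOn_mul (by rw [abs_one]; exact continuousOn_poissonKernel_sphere hw)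
  have hconst : CircleIntegrable (fun z => poissonKernel 0 w 1 * u z) 0 1 :=
    hint.continuousOn_mul continuousOn_const
  have hmul : circleAverage (fun z => poissonKernel 0 w 1 * u z) 0 1 =
      poissonKernel 0 w 1 * circleAverage u 0 1 := by
    simp only [← smul_eq_mul, circleAverage_fun_smul]
  have h := hu.sub_mul_eq_circleAverage hw
  simp only [sub_mul] at h
  rw [circleAverage_fun_sub hPu hconst, hmul] at h
  linear_combination h

end HasRadialBoundaryValuesOffOne

theorem circleMap_zero_one_ne_one {θ : ℝ} (hθ : θ ∈ Ioo 0 (2 * π)) : circleMap 0 1 θ ≠ 1 := by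
  intro h
  have hinj := injOn_circleMap_of_abs_sub_le (c := 0) one_ne_zero
    (a := 0) (b := 2 * π) (by simp [abs_of_pos pi_pos])
  have h₁ : circleMap 0 1 θ = circleMap 0 1 (2 * π) := by simp [h, circleMap_zero]
  rw [uIoc_of_le two_pi_pos.le] at hinj
  exact hθ.2.ne (hinj ⟨hθ.1, hθ.2.le⟩ ⟨two_pi_pos, le_rfl⟩ h₁)

variable {H : ℂ → ℂ}

theorem not_eventually_eq_zero_of_ne_zero_on_ball (hH₀ : ∀ z ∈ ball (0 : ℂ) 1, H z ≠ 0) (θ : ℝ) :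
    ¬ ∀ᶠ z in 𝓝 (circleMap 0 1 θ), H z = 0 := by
  intro h
  obtain ⟨r, hr, hr₁⟩ := exists_seq_tendsto_one
  obtain ⟨n, hn⟩ := ((tendsto_ofReal_mul_nhds hr₁ (circleMap 0 1 θ)).eventually h).exists
  rw [← circleMap_zero_eq_mul] at hn
  exact hH₀ _ (circleMap_zero_mem_ball (hr n) θ) hn

theorem ae_circleMap_ne_zero (hH : ∀ z ∈ closedBall (0 : ℂ) 1, z ≠ 1 → AnalyticAt ℂ H z)
    (hH₀ : ∀ z ∈ ball (0 : ℂ) 1, H z ≠ 0) :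
    ∀ᵐ θ, θ ∈ Ioo 0 (2 * π) → H (circleMap 0 1 θ) ≠ 0 := by
  have hanalytic (θ : ℝ) (hθ : θ ∈ Ioo 0 (2 * π)) : AnalyticAt ℂ H (circleMap 0 1 θ) :=
    hH _ (by simp) (circleMap_zero_one_ne_one hθ)
  refine ae_of_forall_eventually_nhdsNE fun θ hθ => ?_
  have hd := hasDerivAt_circleMap 0 1 θ
  have hne : ∀ᶠ z in 𝓝[≠] circleMap 0 1 θ, H z ≠ 0 :=
    (hanalytic θ hθ).eventually_eq_zero_or_eventually_ne_zero.resolve_left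
      (not_eventually_eq_zero_of_ne_zero_on_ball hH₀ θ)
  exact (hd.tendsto_nhdsNE (by simp [circleMap])).eventually hne

theorem hasRadialBoundaryValuesOffOne_sub_log_norm {C : ℝ}
    (hH : ∀ z ∈ closedBall (0 : ℂ) 1, z ≠ 1 → AnalyticAt ℂ H z)
    (hH₀ : ∀ z ∈ ball (0 : ℂ) 1, H z ≠ 0) (hHC : ∀ z ∈ ball (0 : ℂ) 1, log ‖H z‖ ≤ C) :
    HasRadialBoundaryValuesOffOne fun z => C - log ‖H z‖ where
  harmonicOnNhd z hz :=
    (harmonicAt_const C).sub <| (hH z (ball_subset_closedBall hz)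
      (by rintro rfl; simp at hz)).harmonicAt_log_norm (hH₀ z hz)
  nonneg z hz := sub_nonneg.2 (hHC z hz)
  tendsto := by
    filter_upwards [ae_circleMap_ne_zero hH hH₀] with θ hθ hmem
    have hcont : ContinuousAt (fun z => C - log ‖H z‖) (circleMap 0 1 θ) :=
      continuousAt_const.sub <|
        (hH _ (by simp) (circleMap_zero_one_ne_one hmem)).continuousAt.norm.log
          (norm_ne_zero_iff.2 (hθ hmem))
    have hradial : Tendsto (fun r : ℝ => circleMap 0 r θ) (𝓝[<] 1) (𝓝 (circleMap 0 1 θ)) :=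
      (tendsto_circleMap_nhdsLT_one_prod θ).comp (tendsto_id.prodMk tendsto_const_nhds)
    exact hcont.tendsto.comp hradial
  radiallyDominatedOn K hK hKc := by
    refine (radiallyDominatedOn_of_isCompact hKc fun θ hθ => ?_).const_sub C
    exact exists_nhds_radiallyDominatedOn_log_norm
      (hH _ (by simp) (circleMap_zero_one_ne_one (hK hθ)))
      (not_eventually_eq_zero_of_ne_zero_on_ball hH₀ θ)

end UnitDisc

section CayleyTransform

/-- The Cayley transform, mapping the right half plane onto the unit disc and the point at infinity
to `1`. -/
noncomputable def cayley (s : ℂ) : ℂ := (s - 1) / (s + 1)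

/-- The inverse of `cayley`, from the unit disc onto the right half plane. -/
noncomputable def cayleySymm (z : ℂ) : ℂ := (1 + z) / (1 - z)

/-- The Poisson kernel of the right half plane at `s`, as a density on the imaginary axis. It is not
normalized: its integral is `π`. -/
noncomputable def halfPlanePoissonKernel (s : ℂ) (ω : ℝ) : ℝ :=
  s.re / (s.re ^ 2 + (ω - s.im) ^ 2)

theorem mul_I_mem_closedRHP (ω : ℝ) : (ω : ℂ) * Complex.I ∈ closedRHP := by
  simp [closedRHP]

theorem openRHP_subset_closedRHP : openRHP ⊆ closedRHP := fun s hs =>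
  le_of_lt (show 0 < s.re from hs)

theorem mem_openRHP_of_eq {s : ℂ} {σ η : ℝ} (hσ : 0 < σ) (hs : s = σ + η * Complex.I) :
    s ∈ openRHP := by
  simpa [openRHP, hs] using hσ

theorem add_ne_zero_of_re_pos {s b : ℂ} (hs : s ∈ closedRHP) (hb : 0 < b.re) : s + b ≠ 0 := by
  intro h
  have hre := congrArg Complex.re h
  have hs' : 0 ≤ s.re := hs
  rw [Complex.add_re, Complex.zero_re] at hre
  linarith

theorem add_one_ne_zero_of_mem_closedRHP {s : ℂ} (hs : s ∈ closedRHP) : s + 1 ≠ 0 :=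
  add_ne_zero_of_re_pos hs (by simp)

theorem cayleySymm_cayley {s : ℂ} (hs : s + 1 ≠ 0) : cayleySymm (cayley s) = s := by
  have hsub : 1 - cayley s = 2 / (s + 1) := by unfold cayley; field_simp; ring
  have hadd : 1 + cayley s = 2 * s / (s + 1) := by unfold cayley; field_simp; ring
  rw [cayleySymm, hsub, hadd]
  field_simp

theorem cayley_sub_cayley {s t : ℂ} (hs : s + 1 ≠ 0) (ht : t + 1 ≠ 0) :
    cayley t - cayley s = 2 * (t - s) / ((t + 1) * (s + 1)) := by
  rw [cayley, cayley, div_sub_div _ _ ht hs]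
  ring_nf

theorem one_sub_sq_norm_cayley {s : ℂ} (hs : s + 1 ≠ 0) :
    1 - ‖cayley s‖ ^ 2 = 4 * s.re / ‖s + 1‖ ^ 2 := by
  have hpos : ‖s + 1‖ ^ 2 ≠ 0 := by positivity
  rw [cayley, norm_div, div_pow, eq_div_iff hpos, sub_mul, div_mul_cancel₀ _ hpos, one_mul]
  simp only [← Complex.normSq_eq_norm_sq, Complex.normSq_apply, Complex.add_re, Complex.add_im,
    Complex.sub_re, Complex.sub_im, Complex.one_re, Complex.one_im]
  ring

theorem cayley_mem_ball {s : ℂ} (hs : s ∈ openRHP) : cayley s ∈ ball (0 : ℂ) 1 := by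
  have hs₁ := add_one_ne_zero_of_mem_closedRHP (openRHP_subset_closedRHP hs)
  have hpos : 0 < 1 - ‖cayley s‖ ^ 2 := by
    rw [one_sub_sq_norm_cayley hs₁]
    exact div_pos (mul_pos four_pos hs) (by positivity)
  rw [mem_ball_zero_iff]
  exact lt_of_pow_lt_pow_left₀ 2 zero_le_one (by linarith)

theorem re_cayleySymm (z : ℂ) : (cayleySymm z).re = (1 - ‖z‖ ^ 2) / ‖1 - z‖ ^ 2 := by
  rw [cayleySymm, ← Complex.normSq_eq_norm_sq, ← Complex.normSq_eq_norm_sq, Complex.div_re,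
    ← add_div]
  congr 1
  simp only [Complex.normSq_apply, Complex.add_re, Complex.add_im, Complex.sub_re, Complex.sub_im,
    Complex.one_re, Complex.one_im]
  ring

theorem cayleySymm_mem_closedRHP {z : ℂ} (hz : z ∈ closedBall (0 : ℂ) 1) :
    cayleySymm z ∈ closedRHP := by
  rw [mem_closedBall_zero_iff] at hz
  refine (div_nonneg ?_ (by positivity)).trans_eq (re_cayleySymm z).symm
  linarith [pow_le_one₀ (n := 2) (norm_nonneg z) hz]

theorem cayleySymm_mem_openRHP {z : ℂ} (hz : z ∈ ball (0 : ℂ) 1) : cayleySymm z ∈ openRHP := by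
  rw [mem_ball_zero_iff] at hz
  have hz₁ : 1 - z ≠ 0 := sub_ne_zero.2 fun h => by simp [← h] at hz
  refine (div_pos ?_ (by positivity)).trans_eq (re_cayleySymm z).symm
  linarith [pow_lt_one₀ (norm_nonneg z) hz two_ne_zero]

theorem poissonKernel_cayley_one {s : ℂ} (hs : s + 1 ≠ 0) :
    poissonKernel 0 (cayley s) 1 = s.re := by
  rw [poissonKernel_def, sub_zero, sub_zero, norm_one, one_pow, ← re_cayleySymm,
    cayleySymm_cayley hs]

theorem poissonKernel_cayley_mul_I {s : ℂ} (hs : s ∈ openRHP) (ω : ℝ) :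
    poissonKernel 0 (cayley s) (cayley (ω * Complex.I)) =
      (1 + ω ^ 2) * halfPlanePoissonKernel s ω := by
  have hs₁ := add_one_ne_zero_of_mem_closedRHP (openRHP_subset_closedRHP hs)
  have hω₁ := add_one_ne_zero_of_mem_closedRHP (mul_I_mem_closedRHP ω)
  have hsre : 0 < s.re := hs
  have hcircle : ‖cayley (ω * Complex.I)‖ ^ 2 = 1 := by
    have h := one_sub_sq_norm_cayley hω₁
    rw [Complex.re_ofReal_mul, Complex.I_re, mul_zero, mul_zero, zero_div] at h
    linarith
  have hnum : ‖(ω : ℂ) * Complex.I + 1‖ ^ 2 = 1 + ω ^ 2 := by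
    rw [← Complex.normSq_eq_norm_sq, Complex.normSq_apply]
    simp
    ring
  have hden : ‖(ω : ℂ) * Complex.I - s‖ ^ 2 = s.re ^ 2 + (ω - s.im) ^ 2 := by
    rw [← Complex.normSq_eq_norm_sq, Complex.normSq_apply]
    simp
    ring
  rw [poissonKernel_def, sub_zero, sub_zero, hcircle, one_sub_sq_norm_cayley hs₁,
    cayley_sub_cayley hs₁ hω₁]
  simp only [norm_div, norm_mul, div_pow, mul_pow, hnum, hden, Complex.norm_ofNat,
    halfPlanePoissonKernel]
  field_simp [show s.re ^ 2 + (ω - s.im) ^ 2 ≠ 0 by positivity]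
  ring

theorem circleMap_pi_sub_two_arctan (ω : ℝ) :
    circleMap 0 1 (π - 2 * arctan ω) = cayley (ω * Complex.I) := by
  have hcos_sq : cos (arctan ω) ^ 2 = 1 / (1 + ω ^ 2) := cos_sq_arctan ω
  have hsin : sin (arctan ω) = ω * cos (arctan ω) := by
    rw [← tan_mul_cos (cos_arctan_pos ω).ne', tan_arctan]
  have hcos_two : cos (π - 2 * arctan ω) = 1 - 2 * cos (arctan ω) ^ 2 := by
    rw [cos_pi_sub, cos_two_mul]
    ring
  have hsin_two : sin (π - 2 * arctan ω) = 2 * ω * cos (arctan ω) ^ 2 := by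
    rw [sin_pi_sub, sin_two_mul, hsin]
    ring
  have hpos : (1 : ℝ) + ω ^ 2 ≠ 0 := by positivity
  rw [cayley, eq_div_iff (add_one_ne_zero_of_mem_closedRHP (mul_I_mem_closedRHP ω)), circleMap,
    zero_add, Complex.ofReal_one, one_mul, Complex.exp_mul_I, ← Complex.ofReal_cos,
    ← Complex.ofReal_sin, hcos_two, hsin_two, hcos_sq]
  apply Complex.ext <;> simp [-Complex.ofReal_add] <;> field_simp <;> ring

theorem hasDerivWithinAt_pi_sub_two_arctan (ω : ℝ) (S : Set ℝ) :
    HasDerivWithinAt (fun ω => π - 2 * arctan ω) (-(2 * (1 / (1 + ω ^ 2)))) S ω :=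
  (((hasDerivAt_arctan ω).const_mul 2).const_sub π).hasDerivWithinAt

theorem injOn_pi_sub_two_arctan (S : Set ℝ) : InjOn (fun ω => π - 2 * arctan ω) S :=
  fun x _ y _ h => arctan_injective (by linarith [sub_right_injective h])

theorem image_pi_sub_two_arctan : (fun ω => π - 2 * arctan ω) '' univ = Ioo 0 (2 * π) := by
  ext θ
  simp only [image_univ, mem_range]
  constructor
  · rintro ⟨ω, rfl⟩
    exact ⟨by linarith [arctan_lt_pi_div_two ω], by linarith [neg_pi_div_two_lt_arctan ω]⟩
  · intro hθ
    refine ⟨tan ((π - θ) / 2), ?_⟩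
    rw [arctan_tan (by linarith [hθ.2]) (by linarith [hθ.1])]
    ring

theorem abs_deriv_smul_circleMap_pi_sub_two_arctan (f : ℂ → ℝ) (ω : ℝ) :
    |-(2 * (1 / (1 + ω ^ 2)))| • f (circleMap 0 1 (π - 2 * arctan ω)) =
      2 * ((1 + ω ^ 2)⁻¹ * f (cayley (ω * Complex.I))) := by
  rw [abs_neg, abs_of_nonneg (by positivity), circleMap_pi_sub_two_arctan, smul_eq_mul]
  ring

theorem circleIntegrable_zero_one_iff_cayley {f : ℂ → ℝ} :
    CircleIntegrable f 0 1 ↔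
      Integrable fun ω : ℝ => (1 + ω ^ 2)⁻¹ * f (cayley (ω * Complex.I)) := by
  rw [circleIntegrable_zero_one_iff, ← image_pi_sub_two_arctan,
    integrableOn_image_iff_integrableOn_abs_deriv_smul MeasurableSet.univ
      (fun ω _ => hasDerivWithinAt_pi_sub_two_arctan ω univ) (injOn_pi_sub_two_arctan univ),
    integrableOn_univ]
  simp only [abs_deriv_smul_circleMap_pi_sub_two_arctan]
  exact integrable_const_mul_iff (isUnit_iff_ne_zero.2 two_ne_zero) _

theorem circleAverage_zero_one_eq_integral_cayley (f : ℂ → ℝ) :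
    circleAverage f 0 1 = π⁻¹ * ∫ ω : ℝ, (1 + ω ^ 2)⁻¹ * f (cayley (ω * Complex.I)) := by
  rw [circleAverage_zero_one_eq_setIntegral, ← image_pi_sub_two_arctan,
    integral_image_eq_integral_abs_deriv_smul MeasurableSet.univ
      (fun ω _ => hasDerivWithinAt_pi_sub_two_arctan ω univ) (injOn_pi_sub_two_arctan univ),
    setIntegral_univ]
  simp only [abs_deriv_smul_circleMap_pi_sub_two_arctan]
  rw [integral_const_mul, mul_inv_rev, mul_assoc, inv_mul_cancel_left₀ two_ne_zero]

end CayleyTransform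

section HalfPlane

/-- `HasPoissonIntegral u s a`: the boundary function `ω ↦ u ω` on the imaginary axis is integrable
against the Poisson kernel of the right half plane at `s`, and the normalized integral is `a`. -/
def HasPoissonIntegral (u : ℝ → ℝ) (s : ℂ) (a : ℝ) : Prop :=
  Integrable (fun ω => u ω * halfPlanePoissonKernel s ω) ∧
    ∫ ω, u ω * halfPlanePoissonKernel s ω = π * a

theorem hasPoissonIntegral_neg_iff {u : ℝ → ℝ} {σ η a : ℝ} {s : ℂ} (hs : s = σ + η * Complex.I) :
    HasPoissonIntegral u s (-a) ↔
      Integrable (fun ω => u ω * (σ / (σ ^ 2 + (ω - η) ^ 2))) ∧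
        ∫ ω, u ω * (σ / (σ ^ 2 + (ω - η) ^ 2)) = -π * a := by
  simp [HasPoissonIntegral, halfPlanePoissonKernel, hs]

namespace HasPoissonIntegral

variable {u v : ℝ → ℝ} {s : ℂ} {a b : ℝ}

theorem congr_ae (hu : HasPoissonIntegral u s a) (huv : u =ᵐ[volume] v) :
    HasPoissonIntegral v s a := by
  have hmul : (fun ω => u ω * halfPlanePoissonKernel s ω) =ᵐ[volume]
      fun ω => v ω * halfPlanePoissonKernel s ω := huv.mono fun ω hω => by simp only [hω]
  exact ⟨hu.1.congr hmul, (integral_congr_ae hmul).symm.trans hu.2⟩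

theorem sub (hu : HasPoissonIntegral u s a) (hv : HasPoissonIntegral v s b) :
    HasPoissonIntegral (fun ω => u ω - v ω) s (a - b) := by
  simp only [HasPoissonIntegral, sub_mul]
  refine ⟨hu.1.sub hv.1, ?_⟩
  rw [integral_sub hu.1 hv.1, hu.2, hv.2, mul_sub]

theorem neg (hu : HasPoissonIntegral u s a) : HasPoissonIntegral (fun ω => -u ω) s (-a) := by
  simp only [HasPoissonIntegral, neg_mul, mul_neg]
  exact ⟨hu.1.neg, by rw [integral_neg, hu.2]⟩

theorem nonneg (hu : HasPoissonIntegral u s a) (hs : s ∈ openRHP) (hu₀ : ∀ ω, 0 ≤ u ω) :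
    0 ≤ a := by
  have hint : 0 ≤ π * a := hu.2 ▸ integral_nonneg fun ω => mul_nonneg (hu₀ ω) <|
    div_nonneg (openRHP_subset_closedRHP hs) (by positivity)
  exact nonneg_of_mul_nonneg_right hint pi_pos

theorem of_circleIntegrable {U : ℂ → ℝ} (hU : CircleIntegrable U 0 1) (hs : s ∈ openRHP) :
    HasPoissonIntegral (fun ω => U (cayley (ω * Complex.I))) s
      (circleAverage (fun z => poissonKernel 0 (cayley s) z * U z) 0 1) := by
  have hP := continuousOn_poissonKernel_sphere (cayley_mem_ball hs)
  have hPU : CircleIntegrable (fun z => poissonKernel 0 (cayley s) z * U z) 0 1 :=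
    hU.continuousOn_mul (by rwa [abs_one])
  have hpullback (ω : ℝ) : U (cayley (ω * Complex.I)) * halfPlanePoissonKernel s ω =
      (1 + ω ^ 2)⁻¹ * (poissonKernel 0 (cayley s) (cayley (ω * Complex.I)) *
        U (cayley (ω * Complex.I))) := by
    rw [poissonKernel_cayley_mul_I hs]
    field_simp
  simp only [HasPoissonIntegral, hpullback]
  refine ⟨circleIntegrable_zero_one_iff_cayley.1 hPU, ?_⟩
  rw [circleAverage_zero_one_eq_integral_cayley, mul_inv_cancel_left₀ pi_ne_zero]

theorem const (c : ℝ) (hs : s ∈ openRHP) : HasPoissonIntegral (fun _ => c) s c := by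
  have h := of_circleIntegrable (circleIntegrable_const c 0 1) hs
  have hmul : circleAverage (fun z => c • poissonKernel 0 (cayley s) z) 0 1 = c := by
    rw [circleAverage_fun_smul, circleAverage_poissonKernel (cayley_mem_ball hs), smul_eq_mul,
      mul_one]
  simp only [smul_eq_mul, mul_comm c] at hmul
  rwa [hmul] at h

end HasPoissonIntegral

theorem exists_hasPoissonIntegral_const_sub_log_norm {h : ℂ → ℂ} {C : ℝ}
    (hh : ∀ s ∈ closedRHP, AnalyticAt ℂ h s) (hh₀ : ∀ s ∈ openRHP, h s ≠ 0)
    (hC : ∀ s ∈ openRHP, log ‖h s‖ ≤ C) :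
    ∃ c, 0 ≤ c ∧ ∀ s ∈ openRHP,
      HasPoissonIntegral (fun ω => C - log ‖h (ω * Complex.I)‖) s
        (C - log ‖h s‖ - c * s.re) := by
  have hH : ∀ z ∈ closedBall (0 : ℂ) 1, z ≠ 1 → AnalyticAt ℂ (h ∘ cayleySymm) z := by
    refine fun z hz hz₁ => (hh _ (cayleySymm_mem_closedRHP hz)).comp ?_
    exact AnalyticAt.div (by fun_prop) (by fun_prop) (sub_ne_zero.2 hz₁.symm)
  have hboundary := hasRadialBoundaryValuesOffOne_sub_log_norm hH
    (fun z hz => hh₀ _ (cayleySymm_mem_openRHP hz)) (fun z hz => hC _ (cayleySymm_mem_openRHP hz))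
  obtain ⟨c, hc, hrep⟩ := hboundary.exists_eq_circleAverage_add
  refine ⟨c, hc, fun s hs => ?_⟩
  have hcomp {s : ℂ} (hs : s ∈ closedRHP) : (h ∘ cayleySymm) (cayley s) = h s := by
    rw [Function.comp_apply, cayleySymm_cayley (add_one_ne_zero_of_mem_closedRHP hs)]
  have hs' := openRHP_subset_closedRHP hs
  have hreps := hrep _ (cayley_mem_ball hs)
  rw [hcomp hs', poissonKernel_cayley_one (add_one_ne_zero_of_mem_closedRHP hs')] at hreps
  have hPoisson := HasPoissonIntegral.of_circleIntegrable
    hboundary.circleIntegrable_and_circleAverage_le.1 hs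
  simp only [hcomp (mul_I_mem_closedRHP _)] at hPoisson
  rwa [hreps, add_sub_cancel_right]

/-- The function does not decay exponentially along the positive real axis. This is what excludes
a factor `exp (-(τ * s))`, `τ > 0`, whose modulus on the imaginary axis is `1`. -/
def HasSubexponentialDecay (h : ℂ → ℂ) : Prop :=
  ∀ ε > 0, (fun x : ℝ => exp (-(ε * x))) =O[atTop] fun x : ℝ => h x

namespace HasSubexponentialDecay

variable {h k : ℂ → ℂ}

theorem trans_isBigO (hh : HasSubexponentialDecay h)
    (hhk : (fun x : ℝ => h x) =O[atTop] fun x : ℝ => k x) : HasSubexponentialDecay k :=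
  fun ε hε => (hh ε hε).trans hhk

theorem mul (hh : HasSubexponentialDecay h) (hk : HasSubexponentialDecay k) :
    HasSubexponentialDecay (h * k) := fun ε hε => by
  have hmul := (hh (ε / 2) (half_pos hε)).mul (hk (ε / 2) (half_pos hε))
  simp only [← Real.exp_add] at hmul
  exact hmul.congr_left fun x => by ring_nf

theorem of_inv_pow_isBigO {n : ℕ}
    (hn : (fun x : ℝ => ((x : ℂ) ^ n)⁻¹) =O[atTop] fun x : ℝ => h x) :
    HasSubexponentialDecay h := fun ε hε => by
  have hpow : (fun x : ℝ => (x : ℂ) ^ n) =O[atTop] fun x => exp (ε * x) :=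
    .of_norm_left <| by
      simpa only [norm_pow, Complex.norm_real] using
        (isLittleO_pow_exp_pos_mul_atTop n hε).isBigO.norm_left
  have hinv := hpow.inv_rev <| (eventually_gt_atTop 0).mono fun x hx h₀ =>
    absurd h₀ (pow_ne_zero n (Complex.ofReal_ne_zero.2 hx.ne'))
  simpa only [Real.exp_neg] using hinv.trans hn

theorem nonpos_of_norm_le (hh : HasSubexponentialDecay h) {C c : ℝ}
    (hle : ∀ x : ℝ, 0 < x → ‖h x‖ ≤ exp (C - c * x)) : c ≤ 0 := by
  by_contra! hc
  have hO : (fun x : ℝ => h x) =O[atTop] fun x => exp (C - c * x) :=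
    .of_bound' <| (eventually_gt_atTop 0).mono fun x hx =>
      (hle x hx).trans_eq (Real.norm_of_nonneg (exp_pos _).le).symm
  obtain ⟨b, hb⟩ := isBigO_exp_comp_exp_comp.1 ((hh (c / 2) (half_pos hc)).trans hO)
  obtain ⟨x, hx, hbx⟩ := ((eventually_map.1 hb).and
    (eventually_gt_atTop ((b + C) / (c / 2)))).exists
  rw [div_lt_iff₀ (half_pos hc)] at hbx
  simp only [Pi.sub_apply] at hx
  linarith

end HasSubexponentialDecay

theorem hasPoissonIntegral_log_norm_of_ne_zero {h : ℂ → ℂ} {C : ℝ}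
    (hh : ∀ s ∈ closedRHP, AnalyticAt ℂ h s) (hh₀ : ∀ s ∈ openRHP, h s ≠ 0)
    (hC : ∀ s ∈ closedRHP, ‖h s‖ ≤ C) (hdecay : HasSubexponentialDecay h) {s : ℂ}
    (hs : s ∈ openRHP) :
    HasPoissonIntegral (fun ω => log ‖h (ω * Complex.I)‖) s (log ‖h s‖) := by
  have hlog : ∀ s ∈ closedRHP, log ‖h s‖ ≤ log⁺ C := fun s hs =>
    (le_max_right 0 _).trans (posLog_le_posLog (norm_nonneg _) (hC s hs))
  obtain ⟨c, hc, hrep⟩ := exists_hasPoissonIntegral_const_sub_log_norm hh hh₀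
    fun s hs => hlog s (openRHP_subset_closedRHP hs)
  have hc₀ : c = 0 := by
    refine le_antisymm (hdecay.nonpos_of_norm_le (C := log⁺ C) fun x hx => ?_) hc
    have hx' : (x : ℂ) ∈ openRHP := by simpa [openRHP] using hx
    have hnonneg := (hrep x hx').nonneg hx' fun ω =>
      sub_nonneg.2 (hlog _ (mul_I_mem_closedRHP ω))
    rw [Complex.ofReal_re] at hnonneg
    rw [← log_le_iff_le_exp (norm_pos_iff.2 (hh₀ x hx'))]
    linarith
  simpa only [hc₀, zero_mul, sub_zero, sub_sub_cancel] using
    (HasPoissonIntegral.const (log⁺ C) hs).sub (hrep s hs)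

end HalfPlane

section BoundedAnalytic

/-- The filter of neighbourhoods of infinity in the closed right half plane. -/
noncomputable def atInftyRHP : Filter ℂ := Bornology.cobounded ℂ ⊓ 𝓟 closedRHP

theorem eventually_mem_closedRHP : ∀ᶠ s in atInftyRHP, s ∈ closedRHP :=
  eventually_inf_principal.2 (.of_forall fun _ hs => hs)

theorem tendsto_ofReal_atInftyRHP : Tendsto (fun x : ℝ => (x : ℂ)) atTop atInftyRHP := by
  refine tendsto_inf.2 ⟨tendsto_norm_atTop_iff_cobounded.1 ?_, tendsto_principal.2 ?_⟩
  · simpa only [Complex.norm_real, Real.norm_eq_abs] using tendsto_abs_atTop_atTop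
  · filter_upwards [eventually_ge_atTop 0] with x hx
    simpa [closedRHP] using hx

theorem isClosed_closedRHP : IsClosed closedRHP :=
  isClosed_le continuous_const Complex.continuous_re

theorem exists_norm_le_of_isBigO_one {E F : Type*} [PseudoMetricSpace E] [ProperSpace E]
    [SeminormedAddCommGroup F] {S : Set E} {u : E → F} (hS : IsClosed S) (hu : ContinuousOn u S)
    (hO : u =O[Bornology.cobounded E ⊓ 𝓟 S] fun _ => (1 : ℝ)) : ∃ C, ∀ s ∈ S, ‖u s‖ ≤ C := by
  rcases S.eq_empty_or_nonempty with rfl | ⟨x, -⟩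
  · exact ⟨0, fun s hs => hs.elim⟩
  obtain ⟨C₁, hC₁⟩ := hO.bound
  obtain ⟨R, -, hR⟩ := (hasBasis_cobounded_compl_closedBall x).eventually_iff.1
    (eventually_inf_principal.1 hC₁)
  obtain ⟨C₂, hC₂⟩ := ((isCompact_closedBall x R).inter_right hS).exists_bound_of_continuousOn
    (hu.mono inter_subset_right)
  refine ⟨max C₁ C₂, fun s hs => ?_⟩
  by_cases hsR : s ∈ closedBall x R
  · exact (hC₂ s ⟨hsR, hs⟩).trans (le_max_right _ _)
  · exact ((hR hsR hs).trans_eq (by rw [norm_one, mul_one])).trans (le_max_left _ _)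

theorem exists_analyticAt_eventuallyEq_nhdsNE {u : ℂ → ℂ} {U : Set ℂ} (hu : MeromorphicOn u U)
    (hu₀ : ∀ s ∈ U, 0 ≤ meromorphicOrderAt u s) :
    ∃ k : ℂ → ℂ, (∀ s ∈ U, AnalyticAt ℂ k s) ∧ ∀ s ∈ U, k =ᶠ[𝓝[≠] s] u := by
  refine ⟨toMeromorphicNFOn u U, fun s hs => ?_, fun s hs =>
    hu.toMeromorphicNFOn_eq_self_on_nhdsNE hs⟩
  rw [← (meromorphicNFOn_toMeromorphicNFOn u U hs).meromorphicOrderAt_nonneg_iff_analyticAt,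
    meromorphicOrderAt_toMeromorphicNFOn hu hs]
  exact hu₀ s hs

theorem apply_eq_of_eventuallyEq_nhdsNE {u k : ℂ → ℂ} {s : ℂ} (hk : ContinuousAt k s)
    (hu : ContinuousAt u s) (hku : k =ᶠ[𝓝[≠] s] u) : k s = u s :=
  ((hk.eventuallyEq_nhds_iff_eventuallyEq_nhdsNE hu).1 hku).eq_of_nhds

variable {ι : Type*} {t : Finset ι} {a b : ι → ℂ} {m : ι → ℕ} {s : ℂ}

/-- A finite product of powers of the Möbius transformations `s ↦ (s - a) / (s + b)`. For
`0 < b.re` it is analytic on the closed right half plane, with prescribed zeros. -/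
noncomputable def mobiusProd (t : Finset ι) (a b : ι → ℂ) (m : ι → ℕ) (s : ℂ) : ℂ :=
  ∏ i ∈ t, ((s - a i) / (s + b i)) ^ m i

theorem analyticAt_sub_div_add {a b : ℂ} (hs : s + b ≠ 0) :
    AnalyticAt ℂ (fun z => (z - a) / (z + b)) s :=
  AnalyticAt.div (by fun_prop) (by fun_prop) hs

theorem analyticAt_mobiusProd (hb : ∀ i ∈ t, 0 < (b i).re) (hs : s ∈ closedRHP) :
    AnalyticAt ℂ (mobiusProd t a b m) s :=
  Finset.analyticAt_fun_prod t fun i hi =>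
    (analyticAt_sub_div_add (add_ne_zero_of_re_pos hs (hb i hi))).pow _

theorem mobiusProd_ne_zero (hb : ∀ i ∈ t, 0 < (b i).re) (hs : s ∈ closedRHP)
    (ha : ∀ i ∈ t, s ≠ a i) : mobiusProd t a b m s ≠ 0 :=
  Finset.prod_ne_zero_iff.2 fun i hi => pow_ne_zero _ <|
    div_ne_zero (sub_ne_zero.2 (ha i hi)) (add_ne_zero_of_re_pos hs (hb i hi))

theorem tendsto_mobiusProd_cobounded (t : Finset ι) (a b : ι → ℂ) (m : ι → ℕ) :
    Tendsto (mobiusProd t a b m) (Bornology.cobounded ℂ) (𝓝 1) := by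
  have hfactor (i : ι) :
      Tendsto (fun s => (s - a i) / (s + b i)) (Bornology.cobounded ℂ) (𝓝 1) := by
    have hlim := ((tendsto_inv₀_cobounded.comp
      (tendsto_add_const_cobounded (b i))).const_mul (a i + b i)).const_sub 1
    rw [mul_zero, sub_zero] at hlim
    refine hlim.congr' ?_
    filter_upwards [Bornology.eventually_ne_cobounded (-b i)] with s hs
    have hsb : s + b i ≠ 0 := fun h => hs (eq_neg_of_add_eq_zero_left h)
    simp only [Function.comp_apply]
    field_simp
    ring
  have hprod := tendsto_finsetProd t fun i _ => (hfactor i).pow (m i)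
  simp only [one_pow, Finset.prod_const_one] at hprod
  exact hprod

theorem mobiusProd_isTheta_one (t : Finset ι) (a b : ι → ℂ) (m : ι → ℕ) :
    mobiusProd t a b m =Θ[atInftyRHP] fun _ => (1 : ℂ) :=
  ((isEquivalent_const_iff_tendsto one_ne_zero).2
    ((tendsto_mobiusProd_cobounded t a b m).mono_left inf_le_left)).isTheta

theorem meromorphicOrderAt_sub_div_add [DecidableEq ℂ] {a b : ℂ} (hs : s + b ≠ 0) :
    meromorphicOrderAt (fun z => (z - a) / (z + b)) s = if a = s then 1 else 0 := by
  have han := analyticAt_sub_div_add (a := a) hs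
  split_ifs with has
  · refine (meromorphicOrderAt_eq_int_iff (n := 1) han.meromorphicAt).2
      ⟨fun z => (z + b)⁻¹, AnalyticAt.inv (by fun_prop) hs, inv_ne_zero hs, .of_forall fun z => ?_⟩
    rw [has, zpow_one, smul_eq_mul, div_eq_mul_inv]
  · exact han.meromorphicNFAt.meromorphicOrderAt_eq_zero_iff.2
      (div_ne_zero (sub_ne_zero.2 (Ne.symm has)) hs)

theorem meromorphicOrderAt_mobiusProd [DecidableEq ℂ] (hb : ∀ i ∈ t, 0 < (b i).re)
    (hs : s ∈ closedRHP) :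
    meromorphicOrderAt (mobiusProd t a b m) s =
      ((∑ i ∈ t, if a i = s then m i else 0 : ℕ) : ℤ) := by
  have hfactor : ∀ i ∈ t, AnalyticAt ℂ (fun z => (z - a i) / (z + b i)) s := fun i hi =>
    analyticAt_sub_div_add (add_ne_zero_of_re_pos hs (hb i hi))
  have hprod := meromorphicOrderAt_fun_prod (s := t)
    (f := fun i z => ((z - a i) / (z + b i)) ^ m i) fun i hi => ((hfactor i hi).pow _).meromorphicAt
  refine hprod.trans ?_
  push_cast
  refine Finset.sum_congr rfl fun i hi => ?_
  refine (meromorphicOrderAt_pow (hfactor i hi).meromorphicAt).trans ?_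
  rw [meromorphicOrderAt_sub_div_add (add_ne_zero_of_re_pos hs (hb i hi))]
  split_ifs <;> simp

variable [Fintype ι] {β : ι → ℂ}

/-- The finite Blaschke product of the right half plane with zeros `β`. -/
noncomputable def blaschkeProduct (β : ι → ℂ) : ℂ → ℂ :=
  mobiusProd Finset.univ β (fun i => conj (β i)) 1

theorem blaschkeProduct_apply (β : ι → ℂ) (s : ℂ) :
    blaschkeProduct β s = ∏ i, (s - β i) / (s + conj (β i)) := by
  simp only [blaschkeProduct, mobiusProd, Pi.one_apply, pow_one]

theorem analyticAt_blaschkeProduct (hβ : ∀ i, β i ∈ openRHP) (hs : s ∈ closedRHP) :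
    AnalyticAt ℂ (blaschkeProduct β) s :=
  analyticAt_mobiusProd (fun i _ => (hβ i : 0 < (β i).re)) hs

theorem blaschkeProduct_ne_zero (hβ : ∀ i, β i ∈ openRHP) (hs : s ∈ closedRHP)
    (hsβ : ∀ i, s ≠ β i) : blaschkeProduct β s ≠ 0 :=
  mobiusProd_ne_zero (fun i _ => (hβ i : 0 < (β i).re)) hs fun i _ => hsβ i

theorem log_norm_blaschkeProduct (hβ : ∀ i, β i ∈ openRHP) (hs : s ∈ closedRHP)
    (hsβ : ∀ i, s ≠ β i) :
    log ‖blaschkeProduct β s‖ = ∑ i, log ‖(s - β i) / (s + conj (β i))‖ := by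
  rw [blaschkeProduct_apply, norm_prod]
  exact log_prod fun i _ => norm_ne_zero_iff.2 <|
    div_ne_zero (sub_ne_zero.2 (hsβ i)) (add_ne_zero_of_re_pos hs (hβ i : 0 < (β i).re))

theorem mul_I_ne_of_mem_openRHP (ω : ℝ) {b : ℂ} (hb : b ∈ openRHP) : (ω : ℂ) * Complex.I ≠ b := by
  rintro rfl
  simp [openRHP] at hb

theorem norm_blaschkeProduct_mul_I (hβ : ∀ i, β i ∈ openRHP) (ω : ℝ) :
    ‖blaschkeProduct β (ω * Complex.I)‖ = 1 := by
  rw [blaschkeProduct_apply, norm_prod]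
  refine Finset.prod_eq_one fun i _ => ?_
  have hreflect : (ω : ℂ) * Complex.I + conj (β i) = -conj ((ω : ℂ) * Complex.I - β i) := by
    simp only [map_sub, map_mul, Complex.conj_ofReal, Complex.conj_I]
    ring
  rw [hreflect, norm_div, norm_neg, RCLike.norm_conj,
    div_self (norm_ne_zero_iff.2 (sub_ne_zero.2 (mul_I_ne_of_mem_openRHP ω (hβ i))))]

theorem meromorphicOrderAt_blaschkeProduct (hβ : ∀ i, β i ∈ openRHP) (hs : s ∈ closedRHP) :
    meromorphicOrderAt (blaschkeProduct β) s = (Nat.card {i // β i = s} : ℤ) := by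
  classical
  rw [blaschkeProduct, meromorphicOrderAt_mobiusProd (b := fun i => conj (β i))
    (fun i _ => (hβ i : 0 < (β i).re)) hs]
  simp only [Pi.one_apply, Finset.sum_boole, Nat.card_eq_fintype_card, Fintype.card_subtype,
    Nat.cast_id]

end BoundedAnalytic

section Jensen

variable {h f : ℂ → ℂ} {M N n : ℕ} {α : Fin M → ℂ} {β : Fin N → ℂ} {s : ℂ}

theorem ListsZeros.meromorphicOrderAt_eq_card (hβ : ListsZeros h β) (hh : AnalyticAt ℂ h s)
    (hs : s ∈ openRHP) : meromorphicOrderAt h s = (Nat.card {i // β i = s} : ℤ) := by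
  rw [← hβ.2 s hs, max_eq_left hh.meromorphicOrderAt_nonneg]

theorem ListsZeros.of_meromorphicOrderAt_eq_max (hβ : ListsZeros f β)
    (hh : ∀ s ∈ openRHP, meromorphicOrderAt h s = max (meromorphicOrderAt f s) 0) :
    ListsZeros h β :=
  ⟨hβ.1, fun s hs => by rw [hh s hs, max_eq_left (le_max_right _ _), hβ.2 s hs]⟩

theorem ListsZeros.ne_of_meromorphicOrderAt_nonpos (hβ : ListsZeros h β) (hs : s ∈ openRHP)
    (hh : meromorphicOrderAt h s ≤ 0) (i : Fin N) : s ≠ β i := by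
  rintro rfl
  have hcard := hβ.2 _ hs
  rw [max_eq_right hh] at hcard
  have : Nonempty {j // β j = β i} := ⟨⟨i, rfl⟩⟩
  exact (Nat.card_pos (α := {j // β j = β i})).ne (by exact_mod_cast hcard)

theorem ListsZeros.meromorphicOrderAt_nonpos (hβ : ListsZeros h β) (hs : s ∈ openRHP)
    (hsβ : ∀ i, s ≠ β i) : meromorphicOrderAt h s ≤ 0 := by
  have : IsEmpty {i // β i = s} := ⟨fun i => hsβ i.1 i.2.symm⟩
  have hcard := hβ.2 s hs
  rw [Nat.card_of_isEmpty, Nat.cast_zero, WithTop.coe_zero] at hcard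
  exact (le_max_left _ _).trans_eq hcard

theorem ListsZeros.meromorphicOrderAt_eq_zero (hα : ListsZeros f α) (hβ : ListsZeros f⁻¹ β)
    (hs : s ∈ openRHP) (hsα : ∀ i, s ≠ α i) (hsβ : ∀ i, s ≠ β i) :
    meromorphicOrderAt f s = 0 := by
  have hpos := hα.meromorphicOrderAt_nonpos hs hsα
  have hneg := hβ.meromorphicOrderAt_nonpos hs hsβ
  rw [meromorphicOrderAt_inv] at hneg
  lift meromorphicOrderAt f s to ℤ using ne_top_of_le_ne_top WithTop.zero_ne_top hpos with j
  norm_cast at hpos hneg ⊢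
  omega

theorem exists_eq_mul_blaschkeProduct (hh : ∀ s ∈ closedRHP, AnalyticAt ℂ h s)
    (hβ : ListsZeros h β) :
    ∃ k : ℂ → ℂ, (∀ s ∈ closedRHP, AnalyticAt ℂ k s) ∧ (∀ s ∈ openRHP, k s ≠ 0) ∧
      ∀ s ∈ closedRHP, h s = k s * blaschkeProduct β s := by
  have hB := fun s hs => analyticAt_blaschkeProduct (s := s) hβ.1 hs
  have hordB := fun s hs => meromorphicOrderAt_blaschkeProduct (s := s) hβ.1 hs
  have hord : ∀ s ∈ closedRHP, meromorphicOrderAt (h * (blaschkeProduct β)⁻¹) s =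
      meromorphicOrderAt h s + -(Nat.card {i // β i = s} : ℤ) := fun s hs => by
    rw [meromorphicOrderAt_mul (hh s hs).meromorphicAt (hB s hs).meromorphicAt.inv,
      meromorphicOrderAt_inv, hordB s hs]
  have hord_open : ∀ s ∈ openRHP, meromorphicOrderAt (h * (blaschkeProduct β)⁻¹) s = 0 :=
    fun s hs => by
      have hs' := openRHP_subset_closedRHP hs
      rw [hord s hs', hβ.meromorphicOrderAt_eq_card (hh s hs') hs]
      exact_mod_cast add_neg_cancel (Nat.card {i // β i = s} : ℤ)
  have hord_nonneg : ∀ s ∈ closedRHP, 0 ≤ meromorphicOrderAt (h * (blaschkeProduct β)⁻¹) s := by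
    intro s hs
    by_cases hs' : s ∈ openRHP
    · exact (hord_open s hs').ge
    · have hBs : blaschkeProduct β s ≠ 0 := blaschkeProduct_ne_zero hβ.1 hs fun i hi =>
        hs' (hi ▸ hβ.1 i)
      exact ((hh s hs).mul ((hB s hs).inv hBs)).meromorphicOrderAt_nonneg
  obtain ⟨k, hk, hku⟩ := exists_analyticAt_eventuallyEq_nhdsNE
    (fun s hs => (hh s hs).meromorphicAt.mul (hB s hs).meromorphicAt.inv) hord_nonneg
  refine ⟨k, hk, fun s hs => ?_, fun s hs => ?_⟩
  · have hs' := openRHP_subset_closedRHP hs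
    rw [← (hk s hs').meromorphicNFAt.meromorphicOrderAt_eq_zero_iff,
      meromorphicOrderAt_congr (hku s hs'), hord_open s hs]
  · refine apply_eq_of_eventuallyEq_nhdsNE (hh s hs).continuousAt
      ((hk s hs).mul (hB s hs)).continuousAt ?_
    have hB₀ := (meromorphicOrderAt_ne_top_iff_eventually_ne_zero (hB s hs).meromorphicAt).1
      (hordB s hs ▸ WithTop.coe_ne_top)
    filter_upwards [hku s hs, hB₀] with z hz hBz
    simp only [hz, Pi.mul_apply, Pi.inv_apply, inv_mul_cancel_right₀ hBz]

/-- Bounded analytic functions on the closed right half plane without exponential decay along the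
positive real axis. Jensen's formula for them involves the zeros only. -/
structure IsBoundedAnalytic (h : ℂ → ℂ) : Prop where
  analyticAt : ∀ s ∈ closedRHP, AnalyticAt ℂ h s
  isBigO_one : h =O[atInftyRHP] fun _ => (1 : ℝ)
  hasSubexponentialDecay : HasSubexponentialDecay h

theorem IsBoundedAnalytic.hasPoissonIntegral_log_norm (hh : IsBoundedAnalytic h)
    (hβ : ListsZeros h β) (hs : s ∈ openRHP) (hs₀ : h s ≠ 0) :
    HasPoissonIntegral (fun ω => log ‖h (ω * Complex.I)‖) s
      (log ‖h s‖ - ∑ i, log ‖(s - β i) / (s + conj (β i))‖) := by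
  obtain ⟨k, hk, hk₀, hkB⟩ := exists_eq_mul_blaschkeProduct hh.analyticAt hβ
  have hkΘ : h =Θ[atInftyRHP] k := by
    have hmul := (isTheta_refl k atInftyRHP).mul
      (mobiusProd_isTheta_one Finset.univ β (fun i => conj (β i)) 1)
    simp only [mul_one] at hmul
    have hev : h =ᶠ[atInftyRHP] fun z => k z * blaschkeProduct β z :=
      eventually_mem_closedRHP.mono hkB
    exact hev.trans_isTheta hmul
  obtain ⟨C, hC⟩ := exists_norm_le_of_isBigO_one isClosed_closedRHP
    (fun z hz => (hk z hz).continuousAt.continuousWithinAt) (hkΘ.isBigO_symm.trans hh.isBigO_one)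
  have hrep := hasPoissonIntegral_log_norm_of_ne_zero hk hk₀ hC
    (hh.hasSubexponentialDecay.trans_isBigO
      (hkΘ.isBigO.comp_tendsto tendsto_ofReal_atInftyRHP)) hs
  have hs' := openRHP_subset_closedRHP hs
  have hfact := hkB s hs'
  have hBs : blaschkeProduct β s ≠ 0 := right_ne_zero_of_mul (hfact ▸ hs₀)
  have hsβ := hβ.ne_of_meromorphicOrderAt_nonpos hs
    ((hh.analyticAt s hs').meromorphicNFAt.meromorphicOrderAt_eq_zero_iff.2 hs₀).le
  have haxis (ω : ℝ) : ‖h (ω * Complex.I)‖ = ‖k (ω * Complex.I)‖ := by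
    rw [hkB _ (mul_I_mem_closedRHP ω), norm_mul, norm_blaschkeProduct_mul_I hβ.1, mul_one]
  simp only [haxis]
  rwa [hfact, norm_mul, log_mul (norm_ne_zero_iff.2 (hk₀ s hs)) (norm_ne_zero_iff.2 hBs),
    log_norm_blaschkeProduct hβ.1 hs' hsβ, add_sub_cancel_right]

theorem finite_setOf_meromorphicOrderAt_neg {S : Set ℂ} (hS : IsClosed S)
    (hf : MeromorphicOn f S) (hf' : ∀ᶠ s in Bornology.cobounded ℂ ⊓ 𝓟 S, AnalyticAt ℂ f s) :
    {s ∈ S | meromorphicOrderAt f s < 0}.Finite := by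
  obtain ⟨R, -, hR⟩ := (hasBasis_cobounded_compl_closedBall (0 : ℂ)).eventually_iff.1
    (eventually_inf_principal.1 hf')
  refine ((MeromorphicOn.divisor f (closedBall 0 R ∩ S)).finiteSupport
    ((isCompact_closedBall 0 R).inter_right hS)).subset fun s ⟨hsS, hs⟩ => ?_
  have hsR : s ∈ closedBall (0 : ℂ) R := by
    by_contra hsR
    exact hs.not_ge (hR hsR hsS).meromorphicOrderAt_nonneg
  rw [Function.mem_support, MeromorphicOn.divisor_apply (hf.mono_set inter_subset_right) ⟨hsR, hsS⟩]
  simpa only [ne_eq, WithTop.untop₀_eq_zero, not_or] using ⟨hs.ne, hs.ne_top⟩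

theorem exists_analyticAt_meromorphicOrderAt_eq (P : Finset ℂ) (m : ℂ → ℕ) (n : ℕ) :
    ∃ Q : ℂ → ℂ, (∀ s ∈ closedRHP, AnalyticAt ℂ Q s) ∧
      (∀ s ∈ closedRHP, meromorphicOrderAt Q s = ((if s ∈ P then m s else 0 : ℕ) : ℤ)) ∧
      Q =Θ[atInftyRHP] fun s => (s ^ n)⁻¹ := by
  classical
  have hone : ∀ p ∈ P, 0 < ((fun _ : ℂ => (1 : ℂ)) p).re := fun p _ => one_pos
  have hpow : ∀ s ∈ closedRHP, (s + 1) ^ n ≠ 0 := fun s hs =>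
    pow_ne_zero n (add_one_ne_zero_of_mem_closedRHP hs)
  have hpow' : ∀ s ∈ closedRHP, AnalyticAt ℂ (fun s : ℂ => ((s + 1) ^ n)⁻¹) s := fun s hs =>
    AnalyticAt.inv (by fun_prop) (hpow s hs)
  refine ⟨(fun s => ((s + 1) ^ n)⁻¹) * mobiusProd P id (fun _ => 1) m,
    fun s hs => (hpow' s hs).mul (analyticAt_mobiusProd hone hs), fun s hs => ?_, ?_⟩
  · rw [meromorphicOrderAt_mul_of_ne_zero (hpow' s hs) (inv_ne_zero (hpow s hs)),
      meromorphicOrderAt_mobiusProd hone hs]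
    simp only [id_eq, Finset.sum_ite_eq']
  · have hadd : (fun s : ℂ => s + 1) =Θ[atInftyRHP] fun s => s :=
      ((IsEquivalent.refl.add_isLittleO (isLittleO_const_id_cobounded 1)).mono inf_le_left).isTheta
    have hmul := (hadd.pow n).inv.mul (mobiusProd_isTheta_one P id (fun _ => 1) m)
    simp only [mul_one] at hmul
    exact hmul

theorem exists_analyticAt_mul_eq (hf : MeromorphicOn f closedRHP)
    (hf' : ∀ᶠ s in atInftyRHP, AnalyticAt ℂ f s)
    (hord : ∀ s ∈ closedRHP, meromorphicOrderAt f s ≠ ⊤) (n : ℕ) :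
    ∃ h Q : ℂ → ℂ, (∀ s ∈ closedRHP, AnalyticAt ℂ h s) ∧ (∀ s ∈ closedRHP, AnalyticAt ℂ Q s) ∧
      (∀ s ∈ closedRHP, meromorphicOrderAt h s = max (meromorphicOrderAt f s) 0) ∧
      (∀ s ∈ closedRHP, meromorphicOrderAt Q s = max (meromorphicOrderAt f⁻¹ s) 0) ∧
      (∀ s ∈ closedRHP, AnalyticAt ℂ f s → h s = f s * Q s) ∧
      Q =Θ[atInftyRHP] fun s => (s ^ n)⁻¹ := by
  have hpoles := finite_setOf_meromorphicOrderAt_neg isClosed_closedRHP hf hf'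
  obtain ⟨Q, hQ, hQord, hQΘ⟩ := exists_analyticAt_meromorphicOrderAt_eq hpoles.toFinset
    (fun s => (-(meromorphicOrderAt f s).untop₀).toNat) n
  have hQord' : ∀ s ∈ closedRHP,
      meromorphicOrderAt Q s = max (meromorphicOrderAt f⁻¹ s) 0 := fun s hs => by
    have hs' := hord s hs
    rw [hQord s hs, meromorphicOrderAt_inv]
    simp only [Set.Finite.mem_toFinset, mem_ofPred_eq, hs, true_and]
    lift meromorphicOrderAt f s to ℤ using hs' with j
    rw [WithTop.untop₀_coe]
    norm_cast
    split_ifs <;> omega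
  have hfQord : ∀ s ∈ closedRHP,
      meromorphicOrderAt (f * Q) s = max (meromorphicOrderAt f s) 0 := fun s hs => by
    have hs' := hord s hs
    rw [meromorphicOrderAt_mul (hf s hs) (hQ s hs).meromorphicAt, hQord' s hs,
      meromorphicOrderAt_inv]
    lift meromorphicOrderAt f s to ℤ using hs' with j
    norm_cast
    omega
  obtain ⟨h, hh, hhfQ⟩ := exists_analyticAt_eventuallyEq_nhdsNE
    (fun s hs => (hf s hs).mul (hQ s hs).meromorphicAt) fun s hs =>
      (le_max_right _ _).trans_eq (hfQord s hs).symm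
  refine ⟨h, Q, hh, hQ, fun s hs => ?_, hQord', fun s hs hfs => ?_, hQΘ⟩
  · rw [meromorphicOrderAt_congr (hhfQ s hs), hfQord s hs]
  · exact apply_eq_of_eventuallyEq_nhdsNE (hh s hs).continuousAt
      (hfs.mul (hQ s hs)).continuousAt (hhfQ s hs)

theorem ae_analyticAt_and_ne_zero_mul_I (hf : MeromorphicOn f closedRHP)
    (hord : ∀ s ∈ closedRHP, meromorphicOrderAt f s ≠ ⊤) :
    ∀ᵐ ω : ℝ, AnalyticAt ℂ f (ω * Complex.I) ∧ f (ω * Complex.I) ≠ 0 := by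
  have hae : ∀ᵐ ω : ℝ, ω ∈ univ → AnalyticAt ℂ f (ω * Complex.I) ∧ f (ω * Complex.I) ≠ 0 := by
    refine ae_of_forall_eventually_nhdsNE fun ω _ => ?_
    have hω := mul_I_mem_closedRHP ω
    have hderiv : HasDerivAt (fun t : ℝ => (t : ℂ) * Complex.I) (1 * Complex.I) ω :=
      (Complex.ofRealCLM.hasDerivAt (x := ω)).mul_const _
    exact (hderiv.tendsto_nhdsNE (by simp)).eventually ((hf _ hω).eventually_analyticAt.and
      ((meromorphicOrderAt_ne_top_iff_eventually_ne_zero (hf _ hω)).1 (hord _ hω)))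
  exact hae.mono fun ω hω => hω (mem_univ ω)

theorem exists_isBoundedAnalytic_mul_eq (hf : MeromorphicOn f closedRHP)
    (hf' : ∀ᶠ s in atInftyRHP, AnalyticAt ℂ f s) (hO : f =O[atInftyRHP] fun s => s ^ n)
    (hdecay : HasSubexponentialDecay f)
    (hord : ∀ s ∈ closedRHP, meromorphicOrderAt f s ≠ ⊤) :
    ∃ h Q : ℂ → ℂ, IsBoundedAnalytic h ∧ IsBoundedAnalytic Q ∧
      (∀ s ∈ closedRHP, meromorphicOrderAt h s = max (meromorphicOrderAt f s) 0) ∧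
      (∀ s ∈ closedRHP, meromorphicOrderAt Q s = max (meromorphicOrderAt f⁻¹ s) 0) ∧
      ∀ s ∈ closedRHP, AnalyticAt ℂ f s → h s = f s * Q s := by
  obtain ⟨h, Q, hh, hQ, hhord, hQord, hhfQ, hQΘ⟩ := exists_analyticAt_mul_eq hf hf' hord n
  have hhQ : h =ᶠ[atInftyRHP] f * Q :=
    (eventually_mem_closedRHP.and hf').mono fun z hz => hhfQ z hz.1 hz.2
  have hhO : h =O[atInftyRHP] fun _ => (1 : ℝ) :=
    hhQ.trans_isBigO <| (hO.mul hQΘ.isBigO).trans <| isBigO_of_le _ fun z => by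
      rw [norm_mul, norm_inv, norm_one]
      exact mul_inv_le_one
  have hQO : Q =O[atInftyRHP] fun _ => (1 : ℝ) := hQΘ.isBigO.trans <| .of_bound' <|
    ((eventually_cobounded_le_norm 1).filter_mono inf_le_left).mono fun z hz => by
      rw [norm_inv, norm_pow, norm_one]
      exact inv_le_one_of_one_le₀ (one_le_pow₀ hz)
  have hQdecay : HasSubexponentialDecay Q :=
    .of_inv_pow_isBigO (hQΘ.isBigO_symm.comp_tendsto tendsto_ofReal_atInftyRHP)
  have hhdecay : HasSubexponentialDecay h := (hdecay.mul hQdecay).trans_isBigO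
    (hhQ.symm.isBigO.comp_tendsto tendsto_ofReal_atInftyRHP)
  exact ⟨h, Q, ⟨hh, hhO, hhdecay⟩, ⟨hQ, hQO, hQdecay⟩, hhord, hQord, hhfQ⟩

theorem hasPoissonIntegral_log_norm_of_isBigO_pow (hf : MeromorphicOn f closedRHP)
    (hf' : ∀ᶠ s in atInftyRHP, AnalyticAt ℂ f s) (hO : f =O[atInftyRHP] fun s => s ^ n)
    (hdecay : HasSubexponentialDecay f) (hβ : ListsZeros f β) (hα : ListsZeros f⁻¹ α)
    (hs : s ∈ openRHP) (hfs : AnalyticAt ℂ f s) (hfs₀ : f s ≠ 0) :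
    HasPoissonIntegral (fun ω => log ‖f (ω * Complex.I)‖) s
      (log ‖f s‖ - ∑ i, log ‖(s - β i) / (s + conj (β i))‖ +
        ∑ i, log ‖(s - α i) / (s + conj (α i))‖) := by
  have hs' := openRHP_subset_closedRHP hs
  have hord : ∀ z ∈ closedRHP, meromorphicOrderAt f z ≠ ⊤ := fun z hz =>
    hf.meromorphicOrderAt_ne_top_of_isPreconnected
      (convex_halfSpace_re_ge 0 : Convex ℝ closedRHP).isPreconnected hs' hz
      ((hfs.meromorphicNFAt.meromorphicOrderAt_eq_zero_iff.2 hfs₀).trans_ne WithTop.zero_ne_top)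
  obtain ⟨h, Q, hh, hQ, hhord, hQord, hhfQ⟩ :=
    exists_isBoundedAnalytic_mul_eq hf hf' hO hdecay hord
  have hQ₀ : ∀ z ∈ closedRHP, AnalyticAt ℂ f z → f z ≠ 0 → Q z ≠ 0 := fun z hz hfz hfz₀ => by
    rw [← (hQ.analyticAt z hz).meromorphicNFAt.meromorphicOrderAt_eq_zero_iff, hQord z hz,
      meromorphicOrderAt_inv, hfz.meromorphicNFAt.meromorphicOrderAt_eq_zero_iff.2 hfz₀]
    rfl
  have hlog : ∀ z ∈ closedRHP, AnalyticAt ℂ f z ∧ f z ≠ 0 →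
      log ‖h z‖ - log ‖Q z‖ = log ‖f z‖ := fun z hz ⟨hfz, hfz₀⟩ => by
    rw [hhfQ z hz hfz, norm_mul, log_mul (norm_ne_zero_iff.2 hfz₀)
      (norm_ne_zero_iff.2 (hQ₀ z hz hfz hfz₀)), add_sub_cancel_right]
  have hhP := hh.hasPoissonIntegral_log_norm
    (hβ.of_meromorphicOrderAt_eq_max fun z hz => hhord z (openRHP_subset_closedRHP hz)) hs
    (hhfQ s hs' hfs ▸ mul_ne_zero hfs₀ (hQ₀ s hs' hfs hfs₀))
  have hQP := hQ.hasPoissonIntegral_log_norm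
    (hα.of_meromorphicOrderAt_eq_max fun z hz => hQord z (openRHP_subset_closedRHP hz)) hs
    (hQ₀ s hs' hfs hfs₀)
  have hfP := (hhP.sub hQP).congr_ae ((ae_analyticAt_and_ne_zero_mul_I hf hord).mono fun ω hω =>
    hlog _ (mul_I_mem_closedRHP ω) hω)
  rw [← hlog s hs' ⟨hfs, hfs₀⟩]
  convert hfP using 1
  ring

end Jensen

section Sensitivity

variable {G u : ℂ → ℂ} {M N : ℕ} {α : Fin M → ℂ} {β : Fin N → ℂ} {s : ℂ}

theorem IsTransferFunction.meromorphicOn_one_div_one_add (hG : IsTransferFunction G) :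
    MeromorphicOn (fun s => 1 / (1 + G s)) closedRHP := fun s hs =>
  (MeromorphicAt.const 1 s).div ((MeromorphicAt.const 1 s).add (hG.1 s hs))

theorem meromorphicNFOn_sensitivity (G : ℂ → ℂ) : MeromorphicNFOn (sensitivity G) closedRHP :=
  meromorphicNFOn_toMeromorphicNFOn _ _

theorem sensitivity_inv_eventuallyEq (hG : IsTransferFunction G) (hs : s ∈ closedRHP) :
    (sensitivity G)⁻¹ =ᶠ[𝓝[≠] s] fun z => 1 + G z := by
  filter_upwards [hG.meromorphicOn_one_div_one_add.toMeromorphicNFOn_eq_self_on_nhdsNE hs] with z hz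
  rw [Pi.inv_apply, sensitivity, hz, one_div, inv_inv]

theorem frequently_mem_openRHP (hs : s ∈ closedRHP) : ∃ᶠ z in 𝓝[≠] s, z ∈ openRHP := by
  have hderiv : HasDerivAt (fun t : ℝ => s + t) 1 0 :=
    (Complex.ofRealCLM.hasDerivAt (x := (0 : ℝ))).const_add s
  have hlim := hderiv.tendsto_nhdsNE one_ne_zero
  rw [Complex.ofReal_zero, add_zero] at hlim
  refine (hlim.mono_left (nhdsGT_le_nhdsNE 0)).frequently (Eventually.frequently ?_)
  filter_upwards [self_mem_nhdsWithin] with t ht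
  have hre : 0 < s.re + t := add_pos_of_nonneg_of_pos hs ht
  simpa [openRHP] using hre

theorem analyticAt_and_norm_le_of_frequently {φ : ℂ → ℝ} (hu : MeromorphicNFAt u s)
    (hφ : ContinuousAt φ s) (hle : ∃ᶠ z in 𝓝[≠] s, ‖u z‖ ≤ φ z) :
    AnalyticAt ℂ u s ∧ ‖u s‖ ≤ φ s := by
  have hφ' : Tendsto φ (𝓝[≠] s) (𝓝 (φ s)) := hφ.tendsto.mono_left nhdsWithin_le_nhds
  have hord : 0 ≤ meromorphicOrderAt u s := by
    by_contra! hneg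
    have hu_top := tendsto_norm_atTop_iff_cobounded.2
      (tendsto_cobounded_of_meromorphicOrderAt_neg hneg)
    obtain ⟨z, hz, hzu, hzφ⟩ := (hle.and_eventually ((hu_top.eventually_gt_atTop (φ s + 1)).and
      (hφ'.eventually_lt_const (lt_add_one _)))).exists
    linarith
  have han := hu.meromorphicOrderAt_nonneg_iff_analyticAt.1 hord
  exact ⟨han, le_of_tendsto_of_tendsto_of_frequently
    (han.continuousAt.norm.tendsto.mono_left nhdsWithin_le_nhds) hφ' hle⟩

theorem IsTransferFunction.eventually_analyticAt_and_norm_sensitivity_inv_le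
    (hG : IsTransferFunction G) : ∃ (n : ℕ) (C : ℝ), ∀ᶠ s in atInftyRHP,
      AnalyticAt ℂ (sensitivity G)⁻¹ s ∧ ‖(sensitivity G)⁻¹ s‖ ≤ 1 + C * ‖s‖ ^ n := by
  obtain ⟨n, C, R, hC⟩ := hG.2
  refine ⟨n, C, ?_⟩
  filter_upwards [eventually_mem_closedRHP,
    (tendsto_norm_cobounded_atTop.eventually_gt_atTop R).filter_mono inf_le_left] with s hs hR
  refine analyticAt_and_norm_le_of_frequently (φ := fun z => 1 + C * ‖z‖ ^ n)
    (meromorphicNFOn_sensitivity G hs).inv (by fun_prop) ?_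
  have hR' : ∀ᶠ z in 𝓝[≠] s, R < ‖z‖ :=
    (continuous_norm.continuousAt.eventually_const_lt hR).filter_mono nhdsWithin_le_nhds
  refine ((frequently_mem_openRHP hs).and_eventually
    ((sensitivity_inv_eventuallyEq hG hs).and hR')).mono fun z ⟨hz, hzG, hzR⟩ => ?_
  rw [hzG]
  refine (norm_add_le _ _).trans ?_
  rw [norm_one]
  exact add_le_add_right (hC z (openRHP_subset_closedRHP hz) hzR.le) 1

theorem IsTransferFunction.exists_sensitivity_inv_isBigO_pow (hG : IsTransferFunction G) :
    (∀ᶠ s in atInftyRHP, AnalyticAt ℂ (sensitivity G)⁻¹ s) ∧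
      ∃ n : ℕ, (sensitivity G)⁻¹ =O[atInftyRHP] fun s => s ^ n := by
  obtain ⟨n, C, hC⟩ := hG.eventually_analyticAt_and_norm_sensitivity_inv_le
  refine ⟨hC.mono fun s hs => hs.1, n, .of_bound (1 + C) ?_⟩
  filter_upwards [hC, (eventually_cobounded_le_norm 1).filter_mono inf_le_left] with s hs hs₁
  rw [norm_pow, add_mul, one_mul]
  exact hs.2.trans (add_le_add_left (one_le_pow₀ hs₁) _)

theorem eventually_sensitivity_ne_zero (hα : ListsZeros (sensitivity G) α)
    (hβ : ListsPoles (sensitivity G) β) : ∀ᶠ x : ℝ in atTop, sensitivity G x ≠ 0 := by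
  have hne (b : ℂ) : ∀ᶠ x : ℝ in atTop, (x : ℂ) ≠ b := tendsto_ofReal_atInftyRHP.eventually
    ((Bornology.eventually_ne_cobounded b).filter_mono inf_le_left)
  filter_upwards [eventually_gt_atTop 0, eventually_all.2 fun i => hne (α i),
    eventually_all.2 fun i => hne (β i)] with x hx hxα hxβ
  have hx' : (x : ℂ) ∈ openRHP := by simpa [openRHP] using hx
  have hnf := meromorphicNFOn_sensitivity G (openRHP_subset_closedRHP hx')
  exact hnf.meromorphicOrderAt_eq_zero_iff.1 (hα.meromorphicOrderAt_eq_zero hβ hx' hxα hxβ)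

theorem IsWellPosed.hasSubexponentialDecay_sensitivity_inv (hwp : IsWellPosed G)
    (hg : ∀ᶠ x : ℝ in atTop, sensitivity G x ≠ 0) :
    HasSubexponentialDecay (sensitivity G)⁻¹ := by
  obtain ⟨n, hn⟩ := hwp
  have hn' : (fun x : ℝ => sensitivity G x) =O[atTop] fun x : ℝ => (x : ℂ) ^ n :=
    .of_norm_right <| by simpa only [norm_pow, Complex.norm_real] using hn.norm_right
  exact .of_inv_pow_isBigO (hn'.inv_rev (hg.mono fun x hx h₀ => absurd h₀ hx))

theorem sensitivity_eq_one_of_meromorphicOrderAt_pos (hG : IsTransferFunction G)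
    (hs : s ∈ closedRHP) (hGs : 0 < meromorphicOrderAt G s) : sensitivity G s = 1 := by
  have hlim : Tendsto (sensitivity G)⁻¹ (𝓝[≠] s) (𝓝 1) := by
    have hlim := (tendsto_zero_of_meromorphicOrderAt_pos hGs).const_add 1
    rw [add_zero] at hlim
    exact hlim.congr' (sensitivity_inv_eventuallyEq hG hs).symm
  have hnf := (meromorphicNFOn_sensitivity G hs).inv
  have han := hnf.meromorphicOrderAt_nonneg_iff_analyticAt.1
    ((tendsto_nhds_iff_meromorphicOrderAt_nonneg hnf.meromorphicAt).1 ⟨1, hlim⟩)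
  exact inv_eq_one.1 (tendsto_nhds_unique
    (han.continuousAt.tendsto.mono_left nhdsWithin_le_nhds) hlim)

theorem hasPoissonIntegral_log_norm_sensitivity (hG : IsTransferFunction G)
    (hdecay : HasSubexponentialDecay (sensitivity G)⁻¹) (hα : ListsZeros (sensitivity G) α)
    (hβ : ListsPoles (sensitivity G) β) (hs : s ∈ openRHP)
    (hgs : meromorphicOrderAt (sensitivity G) s = 0) :
    HasPoissonIntegral (fun ω => log ‖sensitivity G (ω * Complex.I)‖) s
      (-(-log ‖sensitivity G s‖ + ∑ i, log ‖(s - α i) / (s + conj (α i))‖ +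
        ∑ i, log ‖(s + conj (β i)) / (s - β i)‖)) := by
  have hs' := openRHP_subset_closedRHP hs
  obtain ⟨han, n, hO⟩ := hG.exists_sensitivity_inv_isBigO_pow
  have hnf := (meromorphicNFOn_sensitivity G hs').inv
  have hford : meromorphicOrderAt (sensitivity G)⁻¹ s = 0 := by
    rw [meromorphicOrderAt_inv, hgs, neg_zero]
  have hf := hasPoissonIntegral_log_norm_of_isBigO_pow
    (meromorphicNFOn_inv.2 (meromorphicNFOn_sensitivity G)).meromorphicOn han hO hdecay hβ
    (by rwa [inv_inv]) hs (hnf.meromorphicOrderAt_nonneg_iff_analyticAt.1 hford.ge)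
    (hnf.meromorphicOrderAt_eq_zero_iff.1 hford)
  have hinv (i : Fin N) : log ‖(s + conj (β i)) / (s - β i)‖ =
      -log ‖(s - β i) / (s + conj (β i))‖ := by rw [← inv_div, norm_inv, log_inv]
  simp only [hinv, Finset.sum_neg_distrib]
  convert hf.neg using 2 <;> simp only [Pi.inv_apply, norm_inv, log_inv] <;> ring

theorem theorem1_general (hG : IsTransferFunction G)
    (hdecay : HasSubexponentialDecay (sensitivity G)⁻¹) (hα : ListsZeros (sensitivity G) α)
    (hβ : ListsPoles (sensitivity G) β) :
    (∀ s ∈ openRHP, (∀ i, s ≠ α i) → (∀ i, s ≠ β i) →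
      HasPoissonIntegral (fun ω => log ‖sensitivity G (ω * Complex.I)‖) s
        (-(-log ‖sensitivity G s‖ + ∑ i, log ‖(s - α i) / (s + conj (α i))‖ +
          ∑ i, log ‖(s + conj (β i)) / (s - β i)‖))) ∧
    ∀ s ∈ openRHP, 0 < meromorphicOrderAt G s → sensitivity G s = 1 ∧
      HasPoissonIntegral (fun ω => log ‖sensitivity G (ω * Complex.I)‖) s
        (-(∑ i, log ‖(s - α i) / (s + conj (α i))‖ +
          ∑ i, log ‖(s + conj (β i)) / (s - β i)‖)) := by
  refine ⟨fun s hs hsα hsβ => hasPoissonIntegral_log_norm_sensitivity hG hdecay hα hβ hs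
    (hα.meromorphicOrderAt_eq_zero hβ hs hsα hsβ), fun s hs hGs => ?_⟩
  have hs' := openRHP_subset_closedRHP hs
  have hone := sensitivity_eq_one_of_meromorphicOrderAt_pos hG hs' hGs
  have hord := (meromorphicNFOn_sensitivity G hs').meromorphicOrderAt_eq_zero_iff.2
    (hone.trans_ne one_ne_zero)
  have hPoisson := hasPoissonIntegral_log_norm_sensitivity hG hdecay hα hβ hs hord
  rw [hone, norm_one, Real.log_one, neg_zero, zero_add] at hPoisson
  exact ⟨hone, hPoisson⟩

end Sensitivity

end

theorem theorem1 (G : ℂ → ℂ) (hG : IsTransferFunction G) (hwp : IsWellPosed G)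
    {M N : ℕ} (α : Fin M → ℂ) (β : Fin N → ℂ)
    (hα : ListsZeros (sensitivity G) α) (hβ : ListsPoles (sensitivity G) β) :
    (∀ (σ η : ℝ) (s₀ : ℂ), 0 < σ → s₀ = (σ : ℂ) + (η : ℂ) * Complex.I →
      (∀ i, s₀ ≠ α i) → (∀ i, s₀ ≠ β i) →
        Integrable (fun ω : ℝ => Real.log ‖sensitivity G ((ω : ℂ) * Complex.I)‖ *
          (σ / (σ ^ 2 + (ω - η) ^ 2))) ∧
        ∫ ω : ℝ, Real.log ‖sensitivity G ((ω : ℂ) * Complex.I)‖ *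
            (σ / (σ ^ 2 + (ω - η) ^ 2)) =
          -Real.pi * (-Real.log ‖sensitivity G s₀‖ +
            ∑ i, Real.log ‖(s₀ - α i) / (s₀ + starRingEnd ℂ (α i))‖ +
            ∑ i, Real.log ‖(s₀ + starRingEnd ℂ (β i)) / (s₀ - β i)‖)) ∧
    (∀ (σ η : ℝ) (ζ : ℂ), 0 < σ → ζ = (σ : ℂ) + (η : ℂ) * Complex.I →
      0 < meromorphicOrderAt G ζ →
        sensitivity G ζ = 1 ∧
        Integrable (fun ω : ℝ => Real.log ‖sensitivity G ((ω : ℂ) * Complex.I)‖ *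
          (σ / (σ ^ 2 + (ω - η) ^ 2))) ∧
        ∫ ω : ℝ, Real.log ‖sensitivity G ((ω : ℂ) * Complex.I)‖ *
            (σ / (σ ^ 2 + (ω - η) ^ 2)) =
          -Real.pi * (∑ i, Real.log ‖(ζ - α i) / (ζ + starRingEnd ℂ (α i))‖ +
            ∑ i, Real.log ‖(ζ + starRingEnd ℂ (β i)) / (ζ - β i)‖)) := by
  obtain ⟨ha, hb⟩ := theorem1_general hG
    (hwp.hasSubexponentialDecay_sensitivity_inv (eventually_sensitivity_ne_zero hα hβ)) hα hβ
  exact ⟨fun σ η s₀ hσ hs₀ hsα hsβ => (hasPoissonIntegral_neg_iff hs₀).1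
      (ha s₀ (mem_openRHP_of_eq hσ hs₀) hsα hsβ),
    fun σ η ζ hσ hζ hGζ => (hb ζ (mem_openRHP_of_eq hσ hζ) hGζ).imp_right
      (hasPoissonIntegral_neg_iff hζ).1⟩
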